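/- **Setting.** Fix $d$ and write $B_s(x)$ for the closed Euclidean ball in $\mathbb R^d$. A set $\omega\subset\mathbb R^d$ is a Delone set if there are $0<r,R<\infty$ with $\|x-y\|\ge r$ for all distinct $x,y\in\omega$ and $B_R(x)\cap\omega\ne\emptyset$ for all $x\in\mathbb R^d$. The closed subsets of $\mathbb R^d$ carry the natural topology, in which the sets $\{G: d_k(F,G)\le\varepsilon\}$ ($\varepsilon>0$, $k\in\mathbb N$) form a neighbourhood basis at $F$, where $$d_k(F,G)=\inf\big(\{\varepsilon>0: F\cap B_k(0)\subset U_\varepsilon(G),\ G\cap B_k(0)\subset U_\varepsilon(F)\}\cup\{1\}\big)$$ and $U_\varepsilon$ is the open $\varepsilon$-neighbourhood. A Delone dynamical system of finite type (DDSF) $(\Omega,T)$ is a set $\Omega$ of Delone sets that is closed in the natural topology, invariant under the translations $T_t\omega=\omega+t$, and such that for every $s>0$ there are, up to translation, only finitely many patterns $(\omega\cap B_s(x),B_s(x))$ with $\omega\in\Omega$, $x\in\omega$. It is uniquely ergodic if there is exactly one $T$-invariant Borel probability measure $\mu$ on $\Omega$. A family $A=(A_\omega)_{\omega\in\Omega}$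 of bounded operators $A_\omega$ on $\ell^2(\omega)$ has finite range if there is $s>0$ such that $(A_\omega\delta_x|\delta_y)=0$ whenever $x,y\in\omega$, $\|x-y\|\ge s$, and $(A_{\omega}\delta_{x+t}|\delta_{y+t})=(A_{\tilde\omega}\delta_x|\delta_y)$ whenever $\omega\cap B_s(x+t)=(\tilde\omega\cap B_s(x))+t$, $x,y\in\tilde\omega$ and $x+t,y+t\in\omega$. Let $\mathcal A$ be the C*-algebra obtained by completing the finite range families in the norm $\|A\|=\sup_\omega\|A_\omega\|$; its elements are the families $(A_\omega)$ which are limits, uniformly in $\omega$, of finite range families. For selfadjoint $A\in\mathcal A$, Borel $B\subset\mathbb R$ and $0\le f\in C_c(\mathbb R^d)$ with $\int f=1$, put $$\rho_A(B)=\tau(\chi_B(A))=\int_\Omega \operatorname{tr}\big(\chi_B(A_\omega)M_f\big)\,d\mu(\omega),$$ where $M_f$ is multiplication by $f$. For bounded $Q\subset\mathbb R^d$ with $|Q|>0$ let $A_\omega|_Q$ be the restriction (compression) of $A_\omega$ to $\ell^2(Q\cap\omega)$, and let $\rho(A_\omega,Q)$ be the measure $\varphi\mapsto |Q|^{-1}\operatorname{tr}\varphi(A_\omega|_Q)$,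 $\varphi\in C_b(\mathbb R)$, i.e. $|Q|^{-1}$ times the sum of the unit masses at the eigenvalues of $A_\omega|_Q$, counted with multiplicity. A van Hove sequence is a sequence of bounded sets $Q_n\subset\mathbb R^d$ with $|Q_n|>0$ and $|\partial_sQ_n|/|Q_n|\to0$ as $n\to\infty$ for every $s>0$, where $\partial_sQ$ is the set of points at distance less than $s$ from the boundary of $Q$. **Theorem.** Let $(\Omega,T)$ be a uniquely ergodic DDSF with invariant probability measure $\mu$, and let $A\in\mathcal A$ be selfadjoint. Then $\rho_A$ is a well-defined finite Borel measure on $\mathbb R$ (the integrals exist and do not depend on $f$), and for every van Hove sequence $(Q_n)$ and every $\omega\in\Omega$ $$\rho(A_\omega,Q_n)\longrightarrow\rho_A\quad\text{weakly as }n\to\infty,$$ i.e. $\int\varphi\,d\rho(A_\omega,Q_n)\to\int\varphi\,d\rho_A$ for every $\varphi\in C_b(\mathbb R)$. -/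

import Mathlib

open Set Filter Topology MeasureTheory
open scoped ENNReal NNReal CompactlySupported

set_option linter.unusedSimpArgs false
set_option linter.unnecessarySeqFocus false

noncomputable section

namespace Delonedyn

/-! ### Spectral projections of bounded selfadjoint operators -/

section Spectral

variable {H : Type*} [NormedAddCommGroup H] [InnerProductSpace ℂ H] [CompleteSpace H]

/-- The positive functional `φ ↦ ⟨v, φ(T) v⟩` on `C_c(ℝ)`, with `φ(T)` given by the continuous
functional calculus of the selfadjoint operator `T`. -/
def spectralFunctional (T : H →L[ℂ] H) (v : H) : C_c(ℝ, ℝ) →ₚ[ℝ] ℝ :=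
  PositiveLinearMap.mk₀
    { toFun := fun φ => (inner ℂ v (cfc (φ : ℝ → ℝ) T v)).re
      map_add' := fun φ ψ => by
        have h : cfc (⇑(φ + ψ)) T = cfc (φ : ℝ → ℝ) T + cfc (ψ : ℝ → ℝ) T :=
          cfc_add T φ ψ φ.continuous.continuousOn ψ.continuous.continuousOn
        rw [h]; simp
      map_smul' := fun c φ => by
        have h : cfc (⇑(c • φ)) T = c • cfc (φ : ℝ → ℝ) T :=
          cfc_smul c (φ : ℝ → ℝ) T φ.continuous.continuousOn
        rw [h]; simp [inner_smul_right_eq_smul] }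
    (fun φ hφ => by
      have h : 0 ≤ cfc (φ : ℝ → ℝ) T := cfc_nonneg fun x _ => hφ x
      have h2 := ((ContinuousLinearMap.nonneg_iff_isPositive _).1 h).inner_nonneg_right v
      exact (RCLike.nonneg_iff.1 h2).1)

/-- The spectral measure of the selfadjoint operator `T` at the vector `v`: the measure with
`∫ φ = ⟨v, φ(T) v⟩` for `φ ∈ C_c(ℝ)`. -/
def spectralMeasure (T : H →L[ℂ] H) (v : H) : Measure ℝ :=
  RealRMK.rieszMeasure (spectralFunctional T v)

theorem integral_spectralMeasure (T : H →L[ℂ] H) (v : H) (φ : C_c(ℝ, ℝ)) :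
    ∫ x, φ x ∂(spectralMeasure T v) = (inner ℂ v (cfc (φ : ℝ → ℝ) T v)).re :=
  RealRMK.integral_rieszMeasure (spectralFunctional T v) φ

theorem spectralMeasure_univ_le (T : H →L[ℂ] H) (v : H) :
    spectralMeasure T v univ ≤ ENNReal.ofReal (‖v‖ ^ 2) := by
  have hR : (spectralMeasure T v).Regular := by unfold spectralMeasure; infer_instance
  rw [isOpen_univ.measure_eq_iSup_isCompact]
  refine iSup₂_le fun K _ => iSup_le fun hK => ?_
  obtain ⟨f, hf1, hf2, _, hf3⟩ :=
    exists_continuousMap_one_of_isCompact_subset_isOpen hK isOpen_univ (Set.subset_univ K)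
  let φ : C_c(ℝ, ℝ) := ⟨f, hf2⟩
  refine (RealRMK.rieszMeasure_le_of_eq_one (spectralFunctional T v) (f := φ)
    (fun x => (hf3 x).1) hK (fun x hx => hf1 hx)).trans (ENNReal.ofReal_le_ofReal ?_)
  change (inner ℂ v (cfc (φ : ℝ → ℝ) T v)).re ≤ _
  have hn : ‖cfc (φ : ℝ → ℝ) T‖ ≤ 1 := norm_cfc_le zero_le_one fun x _ => by
    exact (Real.norm_of_nonneg (hf3 x).1).trans_le (hf3 x).2
  calc (inner ℂ v (cfc (φ : ℝ → ℝ) T v)).re ≤ ‖v‖ * ‖cfc (φ : ℝ → ℝ) T v‖ :=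
        (Complex.re_le_norm _).trans (norm_inner_le_norm _ _)
    _ ≤ ‖v‖ * (1 * ‖v‖) := by gcongr; exact ContinuousLinearMap.le_of_opNorm_le _ hn v
    _ = ‖v‖ ^ 2 := by ring

instance (T : H →L[ℂ] H) (v : H) : IsFiniteMeasure (spectralMeasure T v) :=
  ⟨(spectralMeasure_univ_le T v).trans_lt ENNReal.ofReal_lt_top⟩

theorem spectralMeasure_sum_eq (T : H →L[ℂ] H) {ι κ : Type*} [Fintype ι] [Fintype κ]
    (a : ι → ℝ≥0) (v : ι → H) (b : κ → ℝ≥0) (w : κ → H)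
    (h : ∀ S : H →L[ℂ] H, ∑ i, (a i : ℂ) * inner ℂ (v i) (S (v i)) =
      ∑ j, (b j : ℂ) * inner ℂ (w j) (S (w j))) (B : Set ℝ) :
    ∑ i, (a i : ℝ) * (spectralMeasure T (v i)).real B =
      ∑ j, (b j : ℝ) * (spectralMeasure T (w j)).real B := by
  have key : (∑ i, a i • spectralMeasure T (v i)) = ∑ j, b j • spectralMeasure T (w j) := by
    refine Measure.ext_of_integral_eq_on_compactlySupported fun φ => ?_
    rw [integral_finsetSum_measure (fun i _ => φ.integrable),
      integral_finsetSum_measure (fun i _ => φ.integrable)]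
    simp only [integral_smul_nnreal_measure, integral_spectralMeasure]
    have := congrArg Complex.re (h (cfc (φ : ℝ → ℝ) T))
    simpa [NNReal.smul_def] using this
  have := congrArg (fun ν : Measure ℝ => ν.real B) key
  simp only [measureReal_def, Measure.finsetSum_apply, Measure.smul_apply] at this
  rw [ENNReal.toReal_sum (fun i _ => by rw [ENNReal.smul_def, smul_eq_mul]; finiteness),
    ENNReal.toReal_sum (fun i _ => by rw [ENNReal.smul_def, smul_eq_mul]; finiteness)] at this
  simpa only [measureReal_def, ENNReal.smul_def, smul_eq_mul, ENNReal.toReal_mul,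
    ENNReal.coe_toReal] using this

/-- The symmetric real bilinear form obtained from `v ↦ μ_v(B)` by polarization. -/
def polarForm (T : H →L[ℂ] H) (B : Set ℝ) (v w : H) : ℝ :=
  ((spectralMeasure T (v + w)).real B - (spectralMeasure T (v - w)).real B) / 4

theorem spectralMeasure_real_smul (T : H →L[ℂ] H) (B : Set ℝ) (c : ℂ) (v : H) :
    (spectralMeasure T (c • v)).real B = ‖c‖ ^ 2 * (spectralMeasure T v).real B := by
  have := spectralMeasure_sum_eq T ![1] ![c • v] ![‖c‖₊ ^ 2] ![v] (fun S => by
    have h := Complex.conj_mul' c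
    simp only [Finset.univ_unique, Fin.default_eq_zero, Finset.sum_singleton,
      Matrix.cons_val_fin_one, map_smul, inner_smul_left, inner_smul_right]
    push_cast
    rw [← h]
    ring) B
  simpa using this

theorem polarForm_add_right (T : H →L[ℂ] H) (B : Set ℝ) (v w w' : H) :
    polarForm T B v (w + w') = polarForm T B v w + polarForm T B v w' := by
  have := spectralMeasure_sum_eq T ![1, 1, 1] ![v + (w + w'), v - w, v - w']
    ![1, 1, 1] ![v - (w + w'), v + w, v + w'] (fun S => by
      simp [Fin.sum_univ_three, inner_add_left, inner_add_right, inner_sub_left,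
        inner_sub_right]
      ring) B
  simp [Fin.sum_univ_three] at this
  unfold polarForm
  linarith

theorem polarForm_neg_right (T : H →L[ℂ] H) (B : Set ℝ) (v w : H) :
    polarForm T B v (-w) = -polarForm T B v w := by
  unfold polarForm
  rw [← sub_eq_add_neg, sub_neg_eq_add]
  ring

theorem polarForm_comm (T : H →L[ℂ] H) (B : Set ℝ) (v w : H) :
    polarForm T B v w = polarForm T B w v := by
  have h := spectralMeasure_real_smul T B (-1) (w - v)
  have e : (-1 : ℂ) • (w - v) = v - w := by simp
  rw [e] at h
  unfold polarForm
  rw [add_comm v w, h]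
  simp

theorem polarForm_smul_right (T : H →L[ℂ] H) (B : Set ℝ) (c : ℝ) (v w : H) :
    polarForm T B v ((c : ℂ) • w) = c * polarForm T B v w := by
  have pos : ∀ (c : ℝ≥0) (w : H), polarForm T B v (((c : ℝ) : ℂ) • w) =
      c * polarForm T B v w := fun c w => by
    have := spectralMeasure_sum_eq T ![1, c] ![v + ((c : ℝ) : ℂ) • w, v - w]
      ![1, c] ![v - ((c : ℝ) : ℂ) • w, v + w] (fun S => by
        simp [Fin.sum_univ_two, inner_add_left, inner_add_right, inner_sub_left,
          inner_sub_right, inner_smul_left, inner_smul_right]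
        ring) B
    simp [Fin.sum_univ_two] at this
    unfold polarForm
    simp
    linarith
  rcases le_total 0 c with hc | hc
  · exact pos ⟨c, hc⟩ w
  · have := pos (-c).toNNReal (-w)
    rw [Real.coe_toNNReal _ (neg_nonneg.2 hc), polarForm_neg_right,
      show ((-c : ℝ) : ℂ) • (-w) = (c : ℂ) • w by simp] at this
    rw [this]; ring

theorem polarForm_I_I (T : H →L[ℂ] H) (B : Set ℝ) (v w : H) :
    polarForm T B (Complex.I • v) (Complex.I • w) = polarForm T B v w := by
  unfold polarForm
  rw [← smul_add, ← smul_sub, spectralMeasure_real_smul, spectralMeasure_real_smul]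
  simp

theorem abs_polarForm_le (T : H →L[ℂ] H) (B : Set ℝ) (v w : H) :
    |polarForm T B v w| ≤ ‖v‖ * ‖w‖ := by
  have q : ∀ u : H, 0 ≤ (spectralMeasure T u).real B ∧
      (spectralMeasure T u).real B ≤ ‖u‖ ^ 2 := fun u =>
    ⟨measureReal_nonneg, ENNReal.toReal_le_of_le_ofReal (by positivity)
      ((measure_mono (subset_univ B)).trans (spectralMeasure_univ_le T u))⟩
  have weak : ∀ v w : H, |polarForm T B v w| ≤ (‖v‖ ^ 2 + ‖w‖ ^ 2) / 2 := fun v w => by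
    have h1 := q (v + w)
    have h2 := q (v - w)
    have h3 := parallelogram_law_with_norm ℂ v w
    unfold polarForm
    rw [abs_le]
    constructor <;> nlinarith
  rcases eq_or_ne v 0 with rfl | hv
  · rw [polarForm_comm]; simp [polarForm]
  rcases eq_or_ne w 0 with rfl | hw
  · simp [polarForm]
  have hv' := norm_pos_iff.2 hv
  have hw' := norm_pos_iff.2 hw
  have h := weak ((‖w‖ : ℂ) • v) ((‖v‖ : ℂ) • w)
  rw [polarForm_smul_right, polarForm_comm, polarForm_smul_right, polarForm_comm] at h
  rw [abs_mul, abs_mul, norm_smul, norm_smul] at h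
  simp at h
  have : ‖v‖ * ‖w‖ * |polarForm T B v w| ≤ ‖v‖ * ‖w‖ * (‖v‖ * ‖w‖) := by nlinarith
  exact le_of_mul_le_mul_left this (by positivity)

/-- The complex sesquilinear form with `spectralForm v v = μ_v(B)`. -/
def spectralForm (T : H →L[ℂ] H) (B : Set ℝ) : H →L⋆[ℂ] H →L[ℂ] ℂ :=
  LinearMap.mkContinuous₂
    (LinearMap.mk₂'ₛₗ (starRingEnd ℂ) (RingHom.id ℂ)
      (fun v w => (polarForm T B v w : ℂ) - Complex.I * polarForm T B v (Complex.I • w))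
      (fun v v' w => by
        simp only [polarForm_comm T B _ w, polarForm_comm T B _ (Complex.I • w),
          polarForm_add_right]
        push_cast; ring)
      (fun c v w => by
        have hI : ∀ u w : H, polarForm T B (Complex.I • u) w =
            -polarForm T B u (Complex.I • w) := fun u w => by
          rw [← polarForm_I_I T B u, smul_smul, Complex.I_mul_I, neg_one_smul,
            polarForm_neg_right, neg_neg]
        have hc : c • v = (c.re : ℂ) • v + (c.im : ℂ) • (Complex.I • v) := by
          rw [smul_smul, ← add_smul, Complex.re_add_im]
        have hr : ∀ u : H, polarForm T B (c • v) u =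
            c.re * polarForm T B v u - c.im * polarForm T B v (Complex.I • u) := fun u => by
          rw [hc, polarForm_comm, polarForm_add_right, polarForm_smul_right,
            polarForm_smul_right, polarForm_comm T B u v, polarForm_comm T B u, hI]
          ring
        rw [hr, hr, smul_smul, Complex.I_mul_I, neg_one_smul, polarForm_neg_right]
        apply Complex.ext <;> simp <;> ring)
      (fun v w w' => by
        simp only [smul_add, polarForm_add_right]
        push_cast; ring)
      (fun c v w => by
        have hr : ∀ u : H, polarForm T B v (c • u) =
            c.re * polarForm T B v u + c.im * polarForm T B v (Complex.I • u) := fun u => by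
          rw [← polarForm_smul_right, ← polarForm_smul_right, ← polarForm_add_right,
            smul_smul, ← add_smul, Complex.re_add_im]
        rw [smul_comm Complex.I c w, hr, hr, smul_smul, Complex.I_mul_I, neg_one_smul,
          polarForm_neg_right]
        apply Complex.ext <;> simp <;> ring))
    2 (fun v w => by
      have h1 := abs_polarForm_le T B v w
      have h2 := abs_polarForm_le T B v (Complex.I • w)
      rw [norm_smul, Complex.norm_I, one_mul] at h2
      refine (norm_sub_le _ _).trans ?_
      simp only [norm_mul, Complex.norm_I, one_mul, Complex.norm_real, Real.norm_eq_abs]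
      linarith)

/-- The operator `χ_B(T)` of the Borel functional calculus of a bounded selfadjoint operator `T`:
the bounded operator with `⟨v, χ_B(T) v⟩ = μ_v(B)` for all `v`, where `μ_v` is the spectral
measure of `T` at `v`. -/
def spectralProjection (T : H →L[ℂ] H) (B : Set ℝ) : H →L[ℂ] H :=
  InnerProductSpace.continuousLinearMapOfBilin (spectralForm T B)

theorem inner_spectralProjection (T : H →L[ℂ] H) (B : Set ℝ) (v : H) :
    inner ℂ v (spectralProjection T B v) = ((spectralMeasure T v).real B : ℂ) := by
  have h1 : polarForm T B v v = (spectralMeasure T v).real B := by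
    have := spectralMeasure_real_smul T B 2 v
    rw [two_smul] at this
    have h0 := spectralMeasure_real_smul T B 0 v
    rw [zero_smul] at h0
    unfold polarForm
    rw [this, sub_self, h0]
    norm_num
  have h2 : polarForm T B v (Complex.I • v) = 0 := by
    have h := polarForm_I_I T B v (Complex.I • v)
    rw [smul_smul, Complex.I_mul_I, neg_one_smul, polarForm_neg_right, polarForm_comm] at h
    linarith
  have h : inner ℂ (spectralProjection T B v) v = spectralForm T B v v :=
    InnerProductSpace.continuousLinearMapOfBilin_apply _ _ _
  have h' : spectralForm T B v v =
      (polarForm T B v v : ℂ) - Complex.I * polarForm T B v (Complex.I • v) := rfl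
  rw [← inner_conj_symm, h, h', h1, h2]
  simp

end Spectral

/-! ### Closed subsets of Euclidean space with the natural topology -/

/-- Euclidean space `ℝ^d`. -/
abbrev Euc (d : ℕ) := EuclideanSpace ℝ (Fin d)

/-- The closed subsets of `ℝ^d`. (A type of its own, since `TopologicalSpace.Closeds` carries the
topology of the global Hausdorff distance.) -/
@[ext]
structure ClosedSubset (d : ℕ) where
  /-- The underlying set of points. -/
  carrier : Set (Euc d)
  isClosed : IsClosed carrier

/-- `d_k(F,G) = inf ({ε > 0 : F ∩ B_k ⊆ U_ε(G) and G ∩ B_k ⊆ U_ε(F)} ∪ {1})`, where `B_k` is the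
closed ball around the origin and `U_ε` denotes the open `ε`-neighbourhood. -/
def localDist {d : ℕ} (k : ℕ) (F G : ClosedSubset d) : ℝ :=
  sInf ({ε : ℝ | 0 < ε ∧ F.carrier ∩ Metric.closedBall 0 k ⊆ Metric.thickening ε G.carrier ∧
    G.carrier ∩ Metric.closedBall 0 k ⊆ Metric.thickening ε F.carrier} ∪ {1})

theorem localDist_mono {d : ℕ} {k l : ℕ} (h : k ≤ l) (F G : ClosedSubset d) :
    localDist k F G ≤ localDist l F G := by
  refine csInf_le_csInf ⟨0, ?_⟩ ⟨1, Or.inr rfl⟩ (union_subset_union_left _ ?_)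
  · rintro ε (⟨hε, -⟩ | rfl)
    exacts [hε.le, zero_le_one]
  · rintro ε ⟨hε, h1, h2⟩
    have hb : Metric.closedBall (0 : Euc d) k ⊆ Metric.closedBall 0 l :=
      Metric.closedBall_subset_closedBall (by exact_mod_cast h)
    exact ⟨hε, (inter_subset_inter_right _ hb).trans h1, (inter_subset_inter_right _ hb).trans h2⟩

/-- The natural topology: the sets `{G | d_k(F,G) ≤ ε}` with `ε > 0` and `k ∈ ℕ` form a
neighbourhood basis at `F`. -/
instance naturalTopology (d : ℕ) : TopologicalSpace (ClosedSubset d) where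
  IsOpen U := ∀ F ∈ U, ∃ ε : ℝ, 0 < ε ∧ ∃ k : ℕ, {G | localDist k F G ≤ ε} ⊆ U
  isOpen_univ := fun _ _ => ⟨1, one_pos, 0, Set.subset_univ _⟩
  isOpen_inter := by
    rintro U V hU hV F ⟨hFU, hFV⟩
    obtain ⟨ε, hε, k, h⟩ := hU F hFU
    obtain ⟨ε', hε', k', h'⟩ := hV F hFV
    refine ⟨min ε ε', lt_min hε hε', max k k', fun G hG => ⟨h ?_, h' ?_⟩⟩
    · exact (localDist_mono (le_max_left _ _) F G).trans (le_trans hG (min_le_left _ _))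
    · exact (localDist_mono (le_max_right _ _) F G).trans (le_trans hG (min_le_right _ _))
  isOpen_sUnion := by
    rintro S hS F ⟨U, hU, hF⟩
    obtain ⟨ε, hε, k, h⟩ := hS U hU F hF
    exact ⟨ε, hε, k, h.trans (subset_sUnion_of_mem hU)⟩

instance (d : ℕ) : MeasurableSpace (ClosedSubset d) := borel _

instance (d : ℕ) : BorelSpace (ClosedSubset d) := ⟨rfl⟩

/-- The translate `T_t F = F + t`. -/
def ClosedSubset.translate {d : ℕ} (t : Euc d) (F : ClosedSubset d) : ClosedSubset d where
  carrier := (fun x => x + t) '' F.carrier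
  isClosed := (Homeomorph.addRight t).isClosedMap _ F.isClosed

/-! ### Delone dynamical systems of finite type -/

/-- A Delone set: uniformly discrete and relatively dense. -/
def IsDelone {d : ℕ} (S : Set (Euc d)) : Prop :=
  ∃ D : Delone.DeloneSet (Euc d), D.carrier = S

/-- The intersection of a Delone set with a bounded set is finite. -/
theorem IsDelone.finite_inter {d : ℕ} {S Q : Set (Euc d)} (hS : IsDelone S)
    (hQ : Bornology.IsBounded Q) : {x : S | (x : Euc d) ∈ Q}.Finite := by
  obtain ⟨D, rfl⟩ := hS
  obtain ⟨r, hr, huniq⟩ := D.subset_ball_singleton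
  obtain ⟨t, ht, hcov⟩ := Metric.totallyBounded_iff.1 
    (hQ.isCompact_closure.totallyBounded.subset subset_closure) r hr
  have h : ∀ x : {x : D.carrier | (x : Euc d) ∈ Q}, ∃ c : t, (x.1 : Euc d) ∈ Metric.ball c.1 r :=
    fun x => by
      obtain ⟨c, hc, hx⟩ := mem_iUnion₂.1 (hcov x.2)
      exact ⟨⟨c, hc⟩, hx⟩
  choose c hc using h
  have := ht.to_subtype
  refine Set.finite_coe_iff.1 ?_
  refine Finite.of_injective c fun x y hxy => Subtype.ext (Subtype.ext ?_)
  exact huniq x.1.2 y.1.2 (hc x) (hxy ▸ hc y)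

/-- A Delone dynamical system of finite type (DDSF) on `ℝ^d`: a set of Delone sets which is closed
in the natural topology, invariant under translations, and such that, for every `s > 0`, there are
only finitely many classes, up to translation, of ball patterns `(ω ∩ B_s(x), B_s(x))` with
`ω` in the system and `x ∈ ω`. Each such class is represented here by its unique representative
with support `B_s(0)`. -/
structure DDSF (d : ℕ) where
  /-- The set `Ω` of Delone sets. -/
  carrier : Set (ClosedSubset d)
  isDelone : ∀ ω ∈ carrier, IsDelone ω.carrier
  isClosed : IsClosed carrier
  translate_mem : ∀ t : Euc d, ∀ ω ∈ carrier, ω.translate t ∈ carrier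
  finite_type : ∀ s : ℝ, 0 < s →
    {P : Set (Euc d) | ∃ ω ∈ carrier, ∃ x ∈ ω.carrier,
      P = (ω.translate (-x)).carrier ∩ Metric.closedBall 0 s}.Finite

namespace DDSF

variable {d : ℕ} (Ω : DDSF d)

/-- The points `ω` of the phase space `Ω`, with the subspace topology and its Borel sets. -/
abbrev Point := {ω : ClosedSubset d // ω ∈ Ω.carrier}

/-- The translation action of `ℝ^d` on `Ω`. -/
def translate (t : Euc d) (ω : Ω.Point) : Ω.Point :=
  ⟨ω.1.translate t, Ω.translate_mem t ω.1 ω.2⟩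

/-- A Borel probability measure on `Ω` that is invariant under all translations. -/
structure IsInvariantProbability (μ : Measure Ω.Point) : Prop where
  isProbabilityMeasure : IsProbabilityMeasure μ
  measurePreserving : ∀ t : Euc d, MeasurePreserving (Ω.translate t) μ μ

/-- Unique ergodicity: there is exactly one invariant probability measure. -/
def IsUniquelyErgodic : Prop := ∃! μ : Measure Ω.Point, Ω.IsInvariantProbability μ

variable {Ω}

/-- The Hilbert space `ℓ²(ω)`. -/
abbrev Ell2 (ω : Ω.Point) := lp (fun _ : ω.1.carrier => ℂ) 2

open Classical in
/-- The canonical basis vector `δ_x` of `ℓ²(ω)`. -/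
def delta (ω : Ω.Point) (x : ω.1.carrier) : Ell2 ω := lp.single 2 x (1 : ℂ)

variable (Ω) in
/-- A family `(A_ω)` of bounded operators `A_ω` on `ℓ²(ω)`, `ω ∈ Ω`. -/
abbrev OperatorFamily := (ω : Ω.Point) → (Ell2 ω →L[ℂ] Ell2 ω)

/-- The matrix element `A_ω(x,y) = (A_ω δ_x | δ_y)`. -/
def matrixElement (A : Ω.OperatorFamily) (ω : Ω.Point) (x y : ω.1.carrier) : ℂ :=
  inner ℂ (delta ω y) (A ω (delta ω x))

/-- Operator families of finite range: for some `s > 0` the matrix elements `A_ω(x,y)` vanish if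
`|x - y| ≥ s` and depend only on the pattern of `ω` in the ball `B_s(x)`, up to translation. -/
def IsFiniteRange (A : Ω.OperatorFamily) : Prop :=
  ∃ s : ℝ, 0 < s ∧
    (∀ (ω : Ω.Point) (x y : ω.1.carrier), s ≤ dist (x : Euc d) y → matrixElement A ω x y = 0) ∧
    (∀ (ω ω' : Ω.Point) (t : Euc d) (x y : ω'.1.carrier)
      (hx : (x : Euc d) + t ∈ ω.1.carrier) (hy : (y : Euc d) + t ∈ ω.1.carrier),
      ω.1.carrier ∩ Metric.closedBall ((x : Euc d) + t) s =
        (fun z => z + t) '' (ω'.1.carrier ∩ Metric.closedBall (x : Euc d) s) →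
      matrixElement A ω ⟨x + t, hx⟩ ⟨y + t, hy⟩ = matrixElement A ω' x y)

variable (Ω) in
/-- The C*-algebra `𝒜` of tight binding operators: the completion of the finite range families
for the norm `‖A‖ = sup_ω ‖A_ω‖`, realized as the families that are limits of finite range
families uniformly in `ω`. -/
def tightBindingAlgebra : Set Ω.OperatorFamily :=
  {A | ∀ ε : ℝ, 0 < ε → ∃ B : Ω.OperatorFamily, IsFiniteRange B ∧ ∀ ω, ‖A ω - B ω‖ ≤ ε}

/-! ### The abstract density of states -/

theorem exists_abs_le (f : C_c(Euc d, ℝ)) : ∃ C : ℝ, 0 ≤ C ∧ ∀ x, ‖f x‖ ≤ C := by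
  obtain ⟨C, hC⟩ := f.hasCompactSupport.exists_bound_of_continuous f.continuous
  exact ⟨C, (norm_nonneg _).trans (hC 0), hC⟩

theorem memℓp_mul (f : C_c(Euc d, ℝ)) (ω : Ω.Point) (ψ : Ell2 ω) :
    Memℓp (fun x : ω.1.carrier => (f x : ℂ) * ψ x) 2 := by
  obtain ⟨C, hC0, hC⟩ := exists_abs_le f
  refine ((lp.memℓp ψ).const_mul (C : ℂ)).mono' fun x => ?_
  simp only [norm_mul, Complex.norm_real, Real.norm_of_nonneg hC0]
  gcongr
  exact hC x

/-- The operator `M_f` of multiplication by `f ∈ C_c(ℝ^d)` on `ℓ²(ω)`. -/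
def mulOp (f : C_c(Euc d, ℝ)) (ω : Ω.Point) : Ell2 ω →L[ℂ] Ell2 ω :=
  LinearMap.mkContinuousOfExistsBound
    { toFun := fun ψ => ⟨fun x => (f x : ℂ) * ψ x, memℓp_mul f ω ψ⟩
      map_add' := fun ψ χ => by ext x; exact mul_add _ _ _
      map_smul' := fun c ψ => by ext x; exact mul_left_comm _ _ _ }
    (by
      obtain ⟨C, hC0, hC⟩ := exists_abs_le f
      refine ⟨C, fun ψ => ?_⟩
      have h := lp.norm_mono (p := 2) two_ne_zero
        (x := (⟨fun x => (f x : ℂ) * ψ x, memℓp_mul f ω ψ⟩ : Ell2 ω))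
        (y := ((C : ℂ) • ψ : Ell2 ω)) (fun x => by
          change ‖(f x : ℂ) * ψ x‖ ≤ ‖(C : ℂ) * ψ x‖
          simp only [norm_mul, Complex.norm_real, Real.norm_of_nonneg hC0]
          gcongr
          exact hC x)
      rwa [norm_smul, Complex.norm_real, Real.norm_of_nonneg hC0] at h)

theorem mulOp_apply (f : C_c(Euc d, ℝ)) (ω : Ω.Point) (ψ : Ell2 ω) (x : ω.1.carrier) :
    mulOp f ω ψ x = (f x : ℂ) * ψ x := rfl

/-- The trace of an operator on `ℓ²(ω)`, computed in the canonical basis. -/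
def trace (ω : Ω.Point) (T : Ell2 ω →L[ℂ] Ell2 ω) : ℂ :=
  ∑' x : ω.1.carrier, inner ℂ (delta ω x) (T (delta ω x))

/-- `τ(A) = ∫_Ω tr(A_ω M_f) dμ(ω)`, where `f ≥ 0` is in `C_c(ℝ^d)` with integral one. -/
def tau (μ : Measure Ω.Point) (f : C_c(Euc d, ℝ)) (A : Ω.OperatorFamily) : ℂ :=
  ∫ ω, trace ω (A ω ∘L mulOp f ω) ∂μ

/-- The measure `ρ` is the abstract density of states `ρ_A` of the selfadjoint family `A`, i.e.
`ρ(B) = τ(χ_B(A))` for all Borel sets `B`, for each choice of `f` in the definition of `τ`. -/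
def IsDensityOfStates (μ : Measure Ω.Point) (A : Ω.OperatorFamily) (ρ : FiniteMeasure ℝ) : Prop :=
  ∀ f : C_c(Euc d, ℝ), 0 ≤ f → ∫ x, f x = 1 → ∀ B : Set ℝ, MeasurableSet B →
    Integrable (fun ω => trace ω (spectralProjection (A ω) B ∘L mulOp f ω)) μ ∧
    ((ρ B : ℝ) : ℂ) = tau μ f (fun ω => spectralProjection (A ω) B)

/-! ### Finite volume spectral measures -/

/-- The matrix, in the canonical basis, of the restriction `A_ω|_Q` of `A_ω` to
`ℓ²(Q ∩ ω)`. -/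
def restriction (A : Ω.OperatorFamily) (ω : Ω.Point) (Q : Set (Euc d)) :
    Matrix {x : ω.1.carrier | (x : Euc d) ∈ Q} {x : ω.1.carrier | (x : Euc d) ∈ Q} ℂ :=
  Matrix.of fun x y => inner ℂ (delta ω x) (A ω (delta ω y))

theorem restriction_isHermitian {A : Ω.OperatorFamily} (hA : ∀ ω, IsSelfAdjoint (A ω))
    (ω : Ω.Point) (Q : Set (Euc d)) : (restriction A ω Q).IsHermitian := by
  ext x y
  have h := ContinuousLinearMap.isSelfAdjoint_iff_isSymmetric.1 (hA ω) (delta ω x) (delta ω y)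
  simp only [ContinuousLinearMap.coe_coe] at h
  simp [restriction, h]

open Classical in
/-- The measure `ρ(A_ω, Q) = |Q|⁻¹ ∑ δ_E`, with the sum over the eigenvalues `E` of `A_ω|_Q`
counted with multiplicity. -/
def finiteVolumeMeasure (A : Ω.OperatorFamily) (hA : ∀ ω, IsSelfAdjoint (A ω)) (ω : Ω.Point)
    (Q : Set (Euc d)) (hQ : Bornology.IsBounded Q) : FiniteMeasure ℝ :=
  letI : Fintype {x : ω.1.carrier | (x : Euc d) ∈ Q} :=
    ((Ω.isDelone ω.1 ω.2).finite_inter hQ).fintype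
  (volume Q).toNNReal⁻¹ •
    ∑ i, (diracProba ((restriction_isHermitian hA ω Q).eigenvalues i)).toFiniteMeasure

open Classical in
/-- `⟨ρ(A_ω, Q), φ⟩ = |Q|⁻¹ tr φ(A_ω|_Q)`. -/
theorem integral_finiteVolumeMeasure (A : Ω.OperatorFamily) (hA : ∀ ω, IsSelfAdjoint (A ω))
    (ω : Ω.Point) (Q : Set (Euc d)) (hQ : Bornology.IsBounded Q)
    [hF : Fintype {x : ω.1.carrier | (x : Euc d) ∈ Q}] (φ : BoundedContinuousFunction ℝ ℝ) :
    ((∫ E, φ E ∂(finiteVolumeMeasure A hA ω Q hQ : Measure ℝ) : ℝ) : ℂ) =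
      ((volume.real Q)⁻¹ : ℝ) * (cfc (φ : ℝ → ℝ) (restriction A ω Q)).trace := by
  have hFeq : hF = ((Ω.isDelone ω.1 ω.2).finite_inter hQ).fintype := Subsingleton.elim _ _
  have hM := restriction_isHermitian hA ω Q
  have htr : (cfc (φ : ℝ → ℝ) (restriction A ω Q)).trace =
      ∑ i, ((φ (hM.eigenvalues i) : ℝ) : ℂ) := by
    rw [hM.cfc_eq, Matrix.IsHermitian.cfc, Unitary.conjStarAlgAut_apply, Matrix.trace_mul_comm,
      ← mul_assoc]
    simp [Matrix.trace_diagonal]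
  rw [htr]
  have hμ : (finiteVolumeMeasure A hA ω Q hQ : Measure ℝ) = (volume Q).toNNReal⁻¹ •
      ∑ i, Measure.dirac (hM.eigenvalues i) := by
    unfold finiteVolumeMeasure
    rw [FiniteMeasure.toMeasure_smul, FiniteMeasure.toMeasure_sum]
    subst hFeq
    rfl
  rw [hμ, integral_smul_nnreal_measure,
    integral_finsetSum_measure (fun i _ => φ.integrable _)]
  simp [NNReal.smul_def, measureReal_def]
  exact Or.inl rfl

end DDSF

/-- Van Hove sequences: bounded sets `Q_n` of positive volume with `|∂_s Q_n| / |Q_n| → 0` for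
every `s > 0`, where `∂_s Q` is the set of points with distance less than `s` to the boundary
of `Q`. -/
structure IsVanHove {d : ℕ} (Q : ℕ → Set (Euc d)) : Prop where
  isBounded : ∀ n, Bornology.IsBounded (Q n)
  volume_pos : ∀ n, 0 < volume (Q n)
  tendsto : ∀ s : ℝ, 0 < s →
    Tendsto (fun n => volume.real (Metric.thickening s (frontier (Q n))) / volume.real (Q n))
      atTop (𝓝 0)

end Delonedyn

end

/-!
Finite volume spectra of a selfadjoint family `A` in the tight binding algebra converge because the
diagonal of `φ(A)` is, up to small errors, a local observable of a uniquely ergodic system.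

*Ergodic theorem.* The closed subsets of `ℝ^d` form a compact space in the natural topology, hence
so does `Ω`, and the distances `ω ↦ dist(q, ω)` make it metrizable. A limit point of the normalized
orbit measures of `ω` over a van Hove sequence is invariant, since a translation changes the
averages only by a boundary term. It is therefore equal to `μ`, and by compactness of the space of
probability measures the orbit averages of every continuous function converge to its `μ`-mean, for
every `ω` (`tendsto_orbit_average`).

*Local functions.* Finite local complexity leaves only finitely many vectors of bounded length
between points of the sets in `Ω`. Hence nearby elements of `Ω` agree on a large ball up to a small
translation (`eventually_patchEq`), and `ω ↦ ∑ x ∈ ω, f x * h ω x` is continuous whenever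
`f ∈ C_c(ℝ^d)` and `h ω x` depends only on a patch of `ω` around `x`, or is a uniform limit of such
functions. If `∫ f = 1`, integrating this sum over the translates of `ω` along `Q` gives the sum of
`h ω x` over the points in `Q`, up to a boundary term. So averages of `h` over the points in a van
Hove sequence converge (`tendsto_average_pointsIn`).

*Operators.* By Weierstrass approximation the continuous functional calculus stays in the algebra
(`opCfc_mem_tightBindingAlgebra`), and the diagonal of a member of the algebra is a uniform limit of
local functions (`isAlmostLocal_diagonal`). Thus the averages of `⟨δ_x, φ(A_ω) δ_x⟩` over the points
in `Q_n` converge to `∫ φ dρ` (`integral_densityOfStates`), where `ρ` is the `μ`-average of the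
measures `B ↦ tr(χ_B(A_ω) M_f)`. These depend measurably on `ω`, because their integrals against
bounded continuous functions are continuous in `ω`.

*Restriction to finite volume.* It remains to compare `tr φ(A_ω|_Q)` with the trace of `φ(A_ω)` over
`Q`. For a polynomial in place of `φ` this amounts to comparing the powers of the restriction with
the restrictions of the powers. They differ, up to an error that is small compared with the volume,
only near the boundary of `Q` (`tendsto_sum_norm_truncPow_sub`). The general case follows by
approximating `φ` uniformly on `[-‖A_ω‖, ‖A_ω‖]`, which contains the spectra of both operators
(`tendsto_integral_finiteVolumeMeasure_sub`).

The limit along one van Hove sequence does not involve the weight `f`. Hence neither does `ρ`.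
-/

namespace Delonedyn

/-! ### Compactness and metrizability of the phase space -/

theorem isDelone_nonempty {d : ℕ} {S : Set (Euc d)} (hS : IsDelone S) : S.Nonempty := by
  obtain ⟨D, rfl⟩ := hS
  exact D.nonempty

namespace ClosedSubset

variable {d : ℕ}

theorem thickening_subset_of_localDist_lt {k : ℕ} {F G : ClosedSubset d} {ε : ℝ}
    (h : localDist k F G < ε) (hε : ε ≤ 1) :
    F.carrier ∩ Metric.closedBall 0 k ⊆ Metric.thickening ε G.carrier ∧
      G.carrier ∩ Metric.closedBall 0 k ⊆ Metric.thickening ε F.carrier := by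
  unfold localDist at h
  obtain ⟨δ, hδ, hlt⟩ := exists_lt_of_csInf_lt (Set.Nonempty.inr (singleton_nonempty (1 : ℝ))) h
  rcases hδ with ⟨_, h1, h2⟩ | rfl
  · exact ⟨h1.trans (Metric.thickening_mono hlt.le _), h2.trans (Metric.thickening_mono hlt.le _)⟩
  · exact absurd hlt (not_lt.2 hε)

theorem localDist_le {k : ℕ} {F G : ClosedSubset d} {ε : ℝ} (hε : 0 < ε)
    (h1 : F.carrier ∩ Metric.closedBall 0 k ⊆ Metric.thickening ε G.carrier)
    (h2 : G.carrier ∩ Metric.closedBall 0 k ⊆ Metric.thickening ε F.carrier) :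
    localDist k F G ≤ ε := by
  refine csInf_le ⟨0, ?_⟩ (Or.inl ⟨hε, h1, h2⟩)
  rintro δ (⟨hδ, -⟩ | rfl)
  exacts [hδ.le, zero_le_one]

/-- Meeting a fixed open set is an open condition in the natural topology. -/
theorem isOpen_hit {V : Set (Euc d)} (hV : IsOpen V) :
    IsOpen {F : ClosedSubset d | (F.carrier ∩ V).Nonempty} := by
  rintro F ⟨x, hxF, hxV⟩
  obtain ⟨ε, hε, hb⟩ := Metric.isOpen_iff.1 hV x hxV
  obtain ⟨k, hk⟩ := exists_nat_ge ‖x‖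
  refine ⟨min ε 1 / 2, by positivity, k, fun G hG => ?_⟩
  have hm : 0 < min ε 1 := by positivity
  have h := (thickening_subset_of_localDist_lt (lt_of_le_of_lt hG (half_lt_self hm))
    (min_le_right _ _)).1 ⟨hxF, by simpa using hk⟩
  obtain ⟨y, hy, hxy⟩ := Metric.mem_thickening_iff.1 h
  refine ⟨y, hy, hb ?_⟩
  rw [Metric.mem_ball, dist_comm]
  exact hxy.trans_le (min_le_left _ _)

/-- Missing a fixed compact set is an open condition in the natural topology. -/
theorem isOpen_miss {K : Set (Euc d)} (hK : IsCompact K) :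
    IsOpen {F : ClosedSubset d | F.carrier ∩ K = ∅} := by
  intro F hF
  obtain ⟨δ, hδ, hdisj⟩ := (disjoint_iff_inter_eq_empty.2 hF).symm.exists_thickenings hK F.isClosed
  obtain ⟨R, hR⟩ := hK.isBounded.subset_closedBall 0
  obtain ⟨k, hk⟩ := exists_nat_ge R
  refine ⟨min δ 1 / 2, by positivity, k, fun G hG => ?_⟩
  have hm : 0 < min δ 1 := by positivity
  have h := (thickening_subset_of_localDist_lt (lt_of_le_of_lt hG (half_lt_self hm))
    (min_le_right _ _)).2
  rw [mem_ofPred_eq, eq_empty_iff_forall_notMem]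
  rintro x ⟨hxG, hxK⟩
  have hx : x ∈ Metric.thickening δ F.carrier := Metric.thickening_mono (min_le_left _ _) _
    (h ⟨hxG, Metric.closedBall_subset_closedBall hk (hR hxK)⟩)
  exact disjoint_left.1 hdisj (Metric.self_subset_thickening hδ K hxK) hx

/-- The limit of an ultrafilter consists of the points all of whose neighbourhoods are met by
almost all members. -/
instance : CompactSpace (ClosedSubset d) := by
  refine ⟨isCompact_iff_ultrafilter_le_nhds.2 fun 𝒰 _ => ?_⟩
  let L : Set (Euc d) := {x | ∀ V, IsOpen V → x ∈ V → {G : ClosedSubset d |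
    (G.carrier ∩ V).Nonempty} ∈ 𝒰}
  have hL : IsClosed L := by
    refine isOpen_compl_iff.1 (isOpen_iff_mem_nhds.2 fun x hx => ?_)
    simp only [L, mem_compl_iff, mem_ofPred_eq, not_forall] at hx
    obtain ⟨V, hV, hxV, hnot⟩ := hx
    filter_upwards [hV.mem_nhds hxV] with y hy hyL using hnot (hyL V hV hy)
  refine ⟨⟨L, hL⟩, mem_univ _, fun W hW => ?_⟩
  obtain ⟨U, hUW, hU, hLU⟩ := mem_nhds_iff.1 hW
  obtain ⟨ε, hε, k, hk⟩ := hU _ hLU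
  refine mem_of_superset ?_ (hk.trans hUW)
  have hB : IsCompact (Metric.closedBall (0 : Euc d) k) := isCompact_closedBall _ _
  have h1 : {G : ClosedSubset d |
      L ∩ Metric.closedBall 0 k ⊆ Metric.thickening ε G.carrier} ∈ 𝒰 := by
    obtain ⟨t, ht, hcov⟩ := (hB.inter_left hL).elim_nhds_subcover (fun x => Metric.ball x (ε / 2))
      fun x _ => Metric.ball_mem_nhds x (by positivity)
    have : ∀ x ∈ t, {G : ClosedSubset d | (G.carrier ∩ Metric.ball x (ε / 2)).Nonempty} ∈ 𝒰 :=
      fun x hx => (ht x hx).1 _ Metric.isOpen_ball (Metric.mem_ball_self (by positivity))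
    filter_upwards [(Filter.biInter_finset_mem t).2 this] with G hG x hx
    obtain ⟨z, hz, hxz⟩ := mem_iUnion₂.1 (hcov hx)
    obtain ⟨y, hyG, hy⟩ := mem_iInter₂.1 hG z hz
    refine Metric.mem_thickening_iff.2 ⟨y, hyG, ?_⟩
    rw [Metric.mem_ball] at hy hxz
    linarith [dist_triangle_right x y z]
  have h2 : {G : ClosedSubset d |
      G.carrier ∩ Metric.closedBall 0 k ⊆ Metric.thickening ε L} ∈ 𝒰 := by
    have hC : IsCompact (Metric.closedBall (0 : Euc d) k \ Metric.thickening ε L) :=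
      hB.diff Metric.isOpen_thickening
    have hV : ∀ x ∈ Metric.closedBall (0 : Euc d) k \ Metric.thickening ε L,
        ∃ V, IsOpen V ∧ x ∈ V ∧ {G : ClosedSubset d | (G.carrier ∩ V).Nonempty} ∉ 𝒰 := by
      intro x hx
      by_contra! hcon
      exact hx.2 (Metric.self_subset_thickening hε L fun V hV hxV => hcon V hV hxV)
    choose! V hVo hxV hnot using hV
    obtain ⟨t, ht, hcov⟩ := hC.elim_nhds_subcover V fun x hx => (hVo x hx).mem_nhds (hxV x hx)
    have : ∀ x ∈ t, {G : ClosedSubset d | (G.carrier ∩ V x).Nonempty}ᶜ ∈ 𝒰 :=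
      fun x hx => Ultrafilter.compl_mem_iff_notMem.2 (hnot x (ht x hx))
    filter_upwards [(Filter.biInter_finset_mem t).2 this] with G hG x hx
    by_contra hx'
    obtain ⟨z, hz, hxz⟩ := mem_iUnion₂.1 (hcov ⟨hx.2, hx'⟩)
    exact mem_iInter₂.1 hG z hz ⟨x, hx.1, hxz⟩
  filter_upwards [h1, h2] with G hG1 hG2 using localDist_le hε hG1 hG2

end ClosedSubset

namespace DDSF

variable {d : ℕ} {Ω : DDSF d}

theorem nonempty_carrier (ω : Ω.Point) : ω.1.carrier.Nonempty :=
  isDelone_nonempty (Ω.isDelone _ ω.2)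

theorem finite_inter (ω : Ω.Point) {Q : Set (Euc d)} (hQ : Bornology.IsBounded Q) :
    {x : ω.1.carrier | (x : Euc d) ∈ Q}.Finite :=
  (Ω.isDelone _ ω.2).finite_inter hQ

instance : CompactSpace Ω.Point := isCompact_iff_compactSpace.1 Ω.isClosed.isCompact

theorem continuous_infDist (q : Euc d) :
    Continuous fun ω : Ω.Point => Metric.infDist q ω.1.carrier := by
  refine continuous_iff_continuousAt.2 fun ω => tendsto_order.2 ⟨fun a ha => ?_, fun a ha => ?_⟩
  · have ho : IsOpen {ω : Ω.Point | ω.1.carrier ∩ Metric.closedBall q a = ∅} :=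
      (ClosedSubset.isOpen_miss (isCompact_closedBall q a)).preimage continuous_subtype_val
    have hω : ω.1.carrier ∩ Metric.closedBall q a = ∅ := by
      refine eq_empty_iff_forall_notMem.2 fun x hx => ?_
      have := Metric.infDist_le_dist_of_mem (x := q) hx.1
      have h2 := hx.2
      rw [Metric.mem_closedBall, dist_comm] at h2
      linarith
    filter_upwards [ho.mem_nhds hω] with ω' hω'
    obtain ⟨y, hy, hqy⟩ := ω'.1.isClosed.exists_infDist_eq_dist (nonempty_carrier ω') q
    rw [hqy]
    by_contra! hcon
    exact (eq_empty_iff_forall_notMem.1 hω') y ⟨hy, by rwa [Metric.mem_closedBall, dist_comm]⟩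
  · have ho : IsOpen {ω : Ω.Point | (ω.1.carrier ∩ Metric.ball q a).Nonempty} :=
      (ClosedSubset.isOpen_hit Metric.isOpen_ball).preimage continuous_subtype_val
    have hω : (ω.1.carrier ∩ Metric.ball q a).Nonempty := by
      obtain ⟨y, hy, hqy⟩ := (Metric.infDist_lt_iff (nonempty_carrier ω)).1 ha
      exact ⟨y, hy, by rwa [Metric.mem_ball, dist_comm]⟩
    filter_upwards [ho.mem_nhds hω] with ω' hω'
    obtain ⟨y, hy, hqy⟩ := hω'
    exact (Metric.infDist_le_dist_of_mem hy).trans_lt (by rwa [dist_comm])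

theorem eq_of_infDist_eq {ω ω' : Ω.Point}
    (h : ∀ q, Metric.infDist q ω.1.carrier = Metric.infDist q ω'.1.carrier) : ω = ω' := by
  refine Subtype.ext (ClosedSubset.ext (Set.ext fun q => ?_))
  rw [ω.1.isClosed.mem_iff_infDist_zero (nonempty_carrier ω), h,
    ← ω'.1.isClosed.mem_iff_infDist_zero (nonempty_carrier ω')]

instance : TopologicalSpace.MetrizableSpace Ω.Point := by
  refine Metric.PiNatEmbed.TopologicalSpace.MetrizableSpace.of_countable_separating
    (fun (n : ℕ) (ω : Ω.Point) => Metric.infDist (TopologicalSpace.denseSeq (Euc d) n) ω.1.carrier)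
    (fun n => continuous_infDist _) fun ω ω' hne => ?_
  by_contra! hcon
  refine hne (eq_of_infDist_eq fun q => ?_)
  have := (TopologicalSpace.denseRange_denseSeq (Euc d)).equalizer
    (Metric.continuous_infDist_pt ω.1.carrier) (Metric.continuous_infDist_pt ω'.1.carrier)
    (funext hcon)
  exact congrFun this q

/-- A map into the phase space is continuous as soon as all distances from points of space to its
values are: by compactness, the topology is induced by these distances. -/
theorem continuous_of_infDist {X : Type*} [TopologicalSpace X] {g : X → Ω.Point}
    (h : ∀ q, Continuous fun x => Metric.infDist q (g x).1.carrier) : Continuous g := by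
  have hι : Topology.IsClosedEmbedding
      fun (ω : Ω.Point) (q : Euc d) => Metric.infDist q ω.1.carrier :=
    (continuous_pi continuous_infDist).isClosedEmbedding
      fun ω ω' hω => eq_of_infDist_eq (congrFun hω)
  exact hι.isEmbedding.continuous_iff.2 (continuous_pi h)

theorem infDist_translate (t q : Euc d) (ω : Ω.Point) :
    Metric.infDist q (Ω.translate t ω).1.carrier = Metric.infDist (q - t) ω.1.carrier := by
  have := Metric.infDist_image (Φ := fun x : Euc d => x + t) (isometry_add_right t)
    (x := q - t) (t := ω.1.carrier)
  simpa [translate, ClosedSubset.translate] using this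

theorem continuous_translate (t : Euc d) : Continuous (Ω.translate t) :=
  continuous_of_infDist fun q => by
    simpa only [infDist_translate] using continuous_infDist (q - t)

theorem continuous_orbit (ω : Ω.Point) : Continuous fun t => Ω.translate t ω :=
  continuous_of_infDist fun q => by
    simp only [infDist_translate]
    exact (Metric.continuous_infDist_pt _).comp (by fun_prop)

theorem mem_translate {t z : Euc d} {ω : Ω.Point} :
    z ∈ (Ω.translate t ω).1.carrier ↔ z - t ∈ ω.1.carrier := by
  simp [translate, ClosedSubset.translate, sub_eq_add_neg]

theorem translate_translate (s t : Euc d) (ω : Ω.Point) :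
    Ω.translate s (Ω.translate t ω) = Ω.translate (t + s) ω :=
  Subtype.ext (ClosedSubset.ext (Set.ext fun z => by
    rw [mem_translate, mem_translate, mem_translate, sub_sub, add_comm]))

end DDSF

/-! ### Van Hove sequences and the uniform ergodic theorem -/

section Frontier

variable {d : ℕ}

theorem exists_frontier_mem_segment {S : Set (Euc d)} {x y : Euc d} (hx : x ∈ S) (hy : y ∉ S) :
    ∃ z ∈ segment ℝ x y, z ∈ frontier S := by
  by_contra! hcon
  have hsub : segment ℝ x y ⊆ interior S ∪ interior Sᶜ := fun z hz => by
    have := hcon z hz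
    rw [frontier_eq_closure_inter_closure, mem_inter_iff, not_and_or] at this
    rw [interior_compl, interior_eq_compl_closure_compl]
    exact this.symm
  obtain ⟨z, -, hz1, hz2⟩ := (convex_segment x y).isPreconnected _ _ isOpen_interior
    isOpen_interior hsub
    ⟨x, left_mem_segment ℝ x y, (hsub (left_mem_segment ℝ x y)).resolve_right
      fun h => interior_subset h hx⟩
    ⟨y, right_mem_segment ℝ x y, (hsub (right_mem_segment ℝ x y)).resolve_left
      fun h => hy (interior_subset h)⟩
  exact interior_subset hz2 (interior_subset hz1)

/-- The segment between a point of `S` and a point outside `S` meets the boundary of `S`. -/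
theorem mem_thickening_frontier {S : Set (Euc d)} {x y : Euc d} {b : ℝ} (h : ¬(x ∈ S ↔ y ∈ S))
    (hb : dist x y < b) : x ∈ Metric.thickening b (frontier S) := by
  have hz : ∃ z ∈ segment ℝ x y, z ∈ frontier S := by
    by_cases hx : x ∈ S
    · exact exists_frontier_mem_segment hx fun hy => h (iff_of_true hx hy)
    · rw [segment_symm]
      exact exists_frontier_mem_segment (by tauto) hx
  obtain ⟨z, hz, hzf⟩ := hz
  refine Metric.mem_thickening_iff.2 ⟨z, hzf, ?_⟩
  have := dist_add_dist_of_mem_segment hz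
  linarith [dist_nonneg (x := z) (y := y)]

theorem isBounded_thickening_frontier {S : Set (Euc d)} (hS : Bornology.IsBounded S) (b : ℝ) :
    Bornology.IsBounded (Metric.thickening b (frontier S)) :=
  (hS.closure.subset frontier_subset_closure).thickening

theorem volume_thickening_frontier_ne_top {S : Set (Euc d)} (hS : Bornology.IsBounded S) (b : ℝ) :
    volume (Metric.thickening b (frontier S)) ≠ ∞ :=
  (isBounded_thickening_frontier hS b).measure_lt_top.ne

/-- Averaging a bounded function over a translate changes the integral by at most the volume of a
neighbourhood of the boundary. The closure appears since `S` need not be measurable. -/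
theorem abs_integral_shift_sub_le {S : Set (Euc d)} (hS : Bornology.IsBounded S) {G : Euc d → ℝ}
    (hG : Continuous G) {C : ℝ} (hC : ∀ t, |G t| ≤ C) (s : Euc d) :
    |(∫ t in closure S, G (t - s)) - ∫ t in closure S, G t| ≤
      C * volume.real (Metric.thickening (‖s‖ + 1) (frontier S)) := by
  have hK : IsCompact (closure S) := hS.isCompact_closure
  have hm : MeasurableSet (closure S) := isClosed_closure.measurableSet
  have e1 : ∫ t in closure S, G (t - s) =
      ∫ t, (closure S).indicator (fun t => G (t - s)) (t + s) := by
    rw [integral_add_right_eq_self (fun t => (closure S).indicator (fun t => G (t - s)) t),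
      integral_indicator hm]
  have hi1 : Integrable ((closure S).indicator fun t => G (t - s)) :=
    (integrable_indicator_iff hm).2
      (ContinuousOn.integrableOn_compact hK (by fun_prop))
  have hi2 : Integrable ((closure S).indicator G) :=
    (integrable_indicator_iff hm).2 (ContinuousOn.integrableOn_compact hK hG.continuousOn)
  rw [e1, ← integral_indicator hm, ← integral_sub (hi1.comp_add_right s) hi2]
  set W := Metric.thickening (‖s‖ + 1) (frontier S)
  have hW : MeasurableSet W := Metric.isOpen_thickening.measurableSet
  have hWi : Integrable (W.indicator fun _ => C) :=
    (integrable_indicator_iff hW).2 (integrableOn_const (volume_thickening_frontier_ne_top hS _))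
  have hC0 : 0 ≤ C := (abs_nonneg _).trans (hC 0)
  have hle := norm_integral_le_of_norm_le (μ := volume)
    (f := fun t => (closure S).indicator (fun t => G (t - s)) (t + s) - (closure S).indicator G t)
    hWi (ae_of_all _ fun t => ?_)
  · rw [integral_indicator hW, setIntegral_const, smul_eq_mul, mul_comm] at hle
    exact hle
  · by_cases htW : t ∈ W
    · rw [indicator_of_mem htW]
      by_cases h1 : t + s ∈ closure S <;> by_cases h2 : t ∈ closure S <;>
        simp [h1, h2, hC0, hC t]
    · have hiff : t ∈ closure S ↔ t + s ∈ closure S := by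
        by_contra hcon
        refine htW (Metric.thickening_subset_of_subset _ frontier_closure_subset
          (mem_thickening_frontier hcon ?_))
        simp
      by_cases h2 : t ∈ closure S
      · simp [h2, hiff.1 h2, htW]
      · simp [h2, mt hiff.2 h2, htW]

end Frontier

namespace IsVanHove

variable {d : ℕ} {Q : ℕ → Set (Euc d)}

theorem volume_real_pos (hQ : IsVanHove Q) (n : ℕ) : 0 < volume.real (Q n) :=
  ENNReal.toReal_pos (hQ.volume_pos n).ne' (hQ.isBounded n).measure_lt_top.ne

/-- The sets of a van Hove sequence need not be measurable; passing to their closures does not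
change volumes asymptotically. -/
theorem tendsto_volume_closure (hQ : IsVanHove Q) :
    Tendsto (fun n => volume.real (closure (Q n)) / volume.real (Q n)) atTop (𝓝 1) := by
  have h := (hQ.tendsto 1 one_pos).const_add 1
  rw [add_zero] at h
  refine tendsto_of_tendsto_of_tendsto_of_le_of_le tendsto_const_nhds h (fun n => ?_) fun n => ?_
  · rw [one_le_div (hQ.volume_real_pos n)]
    exact measureReal_mono subset_closure (hQ.isBounded n).closure.measure_lt_top.ne
  · have hp := hQ.volume_real_pos n
    rw [div_le_iff₀ hp, add_mul, one_mul, div_mul_cancel₀ _ hp.ne']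
    have hsub : closure (Q n) ⊆ Q n ∪ Metric.thickening 1 (frontier (Q n)) := by
      rw [closure_eq_self_union_frontier]
      exact union_subset_union_right _ (Metric.self_subset_thickening one_pos _)
    refine (measureReal_mono hsub ?_).trans (measureReal_union_le _ _)
    exact ((hQ.isBounded n).union
      (isBounded_thickening_frontier (hQ.isBounded n) _)).measure_lt_top.ne

theorem volume_closure_ne_zero (hQ : IsVanHove Q) (n : ℕ) : volume (closure (Q n)) ≠ 0 :=
  ((hQ.volume_pos n).trans_le (measure_mono subset_closure)).ne'

theorem volume_closure_ne_top (hQ : IsVanHove Q) (n : ℕ) : volume (closure (Q n)) ≠ ∞ :=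
  (hQ.isBounded n).closure.measure_lt_top.ne

end IsVanHove

namespace DDSF

variable {d : ℕ} {Ω : DDSF d}

/-- The empirical measure of the orbit of `ω` over the closure of `Q n`: the distribution of `ω - t`
for `t` uniformly distributed in the closure. -/
noncomputable def orbitMeasure {Q : ℕ → Set (Euc d)} (hQ : IsVanHove Q) (ω : Ω.Point) (n : ℕ) :
    ProbabilityMeasure Ω.Point :=
  ⟨(ProbabilityTheory.cond volume (closure (Q n))).map fun t => Ω.translate (-t) ω, by
    have := ProbabilityTheory.cond_isProbabilityMeasure_of_finite (μ := volume)
      (hQ.volume_closure_ne_zero n) (hQ.volume_closure_ne_top n)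
    exact Measure.isProbabilityMeasure_map
      ((continuous_orbit ω).comp continuous_neg).measurable.aemeasurable⟩

theorem integral_orbitMeasure {Q : ℕ → Set (Euc d)} (hQ : IsVanHove Q) (ω : Ω.Point) (n : ℕ)
    {g : Ω.Point → ℝ} (hg : Continuous g) :
    ∫ ω', g ω' ∂(orbitMeasure hQ ω n : Measure Ω.Point) =
      (volume.real (closure (Q n)))⁻¹ * ∫ t in closure (Q n), g (Ω.translate (-t) ω) := by
  have hc : Continuous fun t => Ω.translate (-t) ω := (continuous_orbit ω).comp continuous_neg
  change ∫ ω', g ω' ∂(Measure.map (fun t => Ω.translate (-t) ω) _) = _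
  rw [integral_map hc.measurable.aemeasurable hg.aestronglyMeasurable, ProbabilityTheory.cond,
    integral_smul_measure, ENNReal.toReal_inv, smul_eq_mul]
  rfl

/-- Every limit point of the orbit measures is invariant, hence equal to `μ`. -/
theorem eq_of_tendsto_orbitMeasure (hΩ : Ω.IsUniquelyErgodic) {μ : Measure Ω.Point}
    (hμ : Ω.IsInvariantProbability μ) {Q : ℕ → Set (Euc d)} (hQ : IsVanHove Q) (ω : Ω.Point)
    {l : Filter ℕ} [l.NeBot] (hl : l ≤ atTop) {P : ProbabilityMeasure Ω.Point}
    (hP : Tendsto (orbitMeasure hQ ω) l (𝓝 P)) : (P : Measure Ω.Point) = μ := by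
  refine hΩ.unique ⟨inferInstance, fun s => ⟨(continuous_translate s).measurable, ?_⟩⟩ hμ
  have : IsFiniteMeasure (Measure.map (Ω.translate s) (P : Measure Ω.Point)) := inferInstance
  refine ext_of_forall_integral_eq_of_IsFiniteMeasure fun g => ?_
  rw [integral_map (continuous_translate s).measurable.aemeasurable
    g.continuous.aestronglyMeasurable]
  have hlim := ProbabilityMeasure.tendsto_iff_forall_integral_tendsto.1 hP
  have h1 := hlim (g.compContinuous ⟨Ω.translate s, continuous_translate s⟩)
  have h2 := hlim g
  refine sub_eq_zero.1 (tendsto_nhds_unique (h1.sub h2) ?_)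
  have hz : Tendsto (fun n => ‖g‖ * (volume.real (Metric.thickening (‖s‖ + 1) (frontier (Q n))) /
      volume.real (Q n))) l (𝓝 0) := by
    simpa using ((hQ.tendsto (‖s‖ + 1) (by positivity)).mono_left hl).const_mul ‖g‖
  refine squeeze_zero_norm (fun n => ?_) hz
  rw [integral_orbitMeasure hQ ω n (BoundedContinuousFunction.continuous _),
    integral_orbitMeasure hQ ω n g.continuous, ← mul_sub, norm_mul,
    Real.norm_of_nonneg (by positivity)]
  have hG := abs_integral_shift_sub_le (hQ.isBounded n)
    (G := fun t => g (Ω.translate (-t) ω)) (C := ‖g‖)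
    (g.continuous.comp ((continuous_orbit ω).comp continuous_neg))
    (fun t => g.norm_coe_le_norm _) s
  have he : ∀ t, g.compContinuous ⟨Ω.translate s, continuous_translate s⟩ (Ω.translate (-t) ω) =
      g (Ω.translate (-(t - s)) ω) := fun t => by
    simp [translate_translate, sub_eq_add_neg, add_comm]
  simp only [he]
  rw [Real.norm_eq_abs, inv_mul_eq_div, mul_div_assoc']
  have hpos := hQ.volume_real_pos n
  refine div_le_div₀ (by positivity) hG hpos ?_
  exact measureReal_mono subset_closure (hQ.volume_closure_ne_top n)

/-- The ergodic theorem: by compactness of the space of probability measures, the orbit measures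
converge to the unique invariant measure, for each point of the system. -/
theorem tendsto_orbit_average (hΩ : Ω.IsUniquelyErgodic) {μ : Measure Ω.Point}
    (hμ : Ω.IsInvariantProbability μ) {Q : ℕ → Set (Euc d)} (hQ : IsVanHove Q) (ω : Ω.Point)
    {g : Ω.Point → ℝ} (hg : Continuous g) :
    Tendsto (fun n => (volume.real (Q n))⁻¹ * ∫ t in closure (Q n), g (Ω.translate (-t) ω))
      atTop (𝓝 (∫ ω', g ω' ∂μ)) := by
  have key : Tendsto (fun n => ∫ ω', g ω' ∂(orbitMeasure hQ ω n : Measure Ω.Point)) atTop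
      (𝓝 (∫ ω', g ω' ∂μ)) := by
    rw [tendsto_iff_ultrafilter]
    intro 𝒰 h𝒰
    obtain ⟨P, -, hP⟩ := isCompact_univ.ultrafilter_le_nhds (𝒰.map (orbitMeasure hQ ω)) (by simp)
    have hP' : Tendsto (orbitMeasure hQ ω) 𝒰 (𝓝 P) := hP
    rw [← eq_of_tendsto_orbitMeasure hΩ hμ hQ ω h𝒰 hP']
    exact ProbabilityMeasure.tendsto_iff_forall_integral_tendsto.1 hP'
      (BoundedContinuousFunction.mkOfCompact ⟨g, hg⟩)
  have := hQ.tendsto_volume_closure.mul key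
  rw [one_mul] at this
  refine this.congr fun n => ?_
  rw [integral_orbitMeasure hQ ω n hg, ← mul_assoc]
  congr 1
  have h1 := hQ.volume_real_pos n
  have h2 : 0 < volume.real (closure (Q n)) :=
    ENNReal.toReal_pos (hQ.volume_closure_ne_zero n) (hQ.volume_closure_ne_top n)
  field_simp

/-! ### Finite local complexity -/

/-- The patches of radius `s` of `ω` around `a` and of `ω'` around `b` agree up to translation. -/
def PatchEq (s : ℝ) (ω ω' : Ω.Point) (a b : Euc d) : Prop :=
  ∀ z : Euc d, ‖z‖ ≤ s → (a + z ∈ ω.1.carrier ↔ b + z ∈ ω'.1.carrier)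

theorem PatchEq.mono {s s' : ℝ} {ω ω' : Ω.Point} {a b : Euc d} (h : PatchEq s ω ω' a b)
    (hs : s' ≤ s) : PatchEq s' ω ω' a b := fun z hz => h z (hz.trans hs)

theorem PatchEq.shift {s r : ℝ} {ω ω' : Ω.Point} {a b e : Euc d} (h : PatchEq s ω ω' a b)
    (hr : r + ‖e‖ ≤ s) : PatchEq r ω ω' (a + e) (b + e) := fun z hz => by
  rw [add_assoc, add_assoc]
  exact h (e + z) ((norm_add_le _ _).trans (by linarith))

theorem patchEq_translate (s : ℝ) (ω : Ω.Point) (t x : Euc d) :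
    PatchEq s (Ω.translate t ω) ω (x + t) x := fun z _ => by
  rw [mem_translate, show x + t + z - t = x + z by abel]

theorem image_eq_of_patchEq {s : ℝ} {ω ω' : Ω.Point} {a b t : Euc d} (hab : a = b + t)
    (h : PatchEq s ω ω' a b) : ω.1.carrier ∩ Metric.closedBall a s =
      (fun z => z + t) '' (ω'.1.carrier ∩ Metric.closedBall b s) := by
  ext z
  simp only [image_add_right, mem_preimage, mem_inter_iff, Metric.mem_closedBall, dist_eq_norm]
  rw [show z + -t - b = z - a by rw [hab]; abel]
  refine and_congr_left fun hz => ?_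
  have := h (z - a) hz
  rwa [add_sub_cancel, show b + (z - a) = z + -t by rw [hab]; abel] at this

theorem patchEq_of_image_eq {s : ℝ} {ω ω' : Ω.Point} {b t : Euc d}
    (h : ω.1.carrier ∩ Metric.closedBall (b + t) s =
      (fun z => z + t) '' (ω'.1.carrier ∩ Metric.closedBall b s)) :
    PatchEq s ω ω' (b + t) b := fun z hz => by
  have := congrArg (fun S : Set (Euc d) => b + t + z ∈ S) h
  simp only [image_add_right, mem_preimage, mem_inter_iff, Metric.mem_closedBall, dist_eq_norm,
    show b + t + z + -t = b + z by abel, add_sub_cancel_left, hz, and_true] at this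
  exact Eq.to_iff this

/-- The patch of `ω` of radius `s` around `x`, translated to the origin. -/
def patch (s : ℝ) (ω : Ω.Point) (x : Euc d) : Set (Euc d) :=
  (ω.1.translate (-x)).carrier ∩ Metric.closedBall 0 s

theorem mem_patch {s : ℝ} {ω : Ω.Point} {x z : Euc d} :
    z ∈ patch s ω x ↔ x + z ∈ ω.1.carrier ∧ ‖z‖ ≤ s := by
  have h : z ∈ (ω.1.translate (-x)).carrier ↔ x + z ∈ ω.1.carrier := by
    have := mem_translate (t := -x) (z := z) (ω := ω)
    rwa [sub_neg_eq_add, add_comm z x] at this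
  rw [patch, mem_inter_iff, h, mem_closedBall_zero_iff]

theorem patchEq_of_patch_eq {s : ℝ} {ω ω' : Ω.Point} {a b : Euc d}
    (h : patch s ω a = patch s ω' b) : PatchEq s ω ω' a b := fun z hz => by
  have := Set.ext_iff.1 h z
  rw [mem_patch, mem_patch] at this
  tauto

theorem finite_patches (Ω : DDSF d) {s : ℝ} (hs : 0 < s) :
    (range fun p : Σ ω : Ω.Point, ω.1.carrier => patch s p.1 p.2).Finite := by
  refine (Ω.finite_type s hs).subset ?_
  rintro _ ⟨⟨ω, x⟩, rfl⟩
  exact ⟨ω.1, ω.2, x.1, x.2, rfl⟩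

variable (Ω) in
/-- The difference vectors of length at most `s` between points of sets in the system. -/
def differences (s : ℝ) : Set (Euc d) :=
  {e | ‖e‖ ≤ s ∧ ∃ ω : Ω.Point, ∃ x ∈ ω.1.carrier, x + e ∈ ω.1.carrier}

theorem finite_differences (Ω : DDSF d) {s : ℝ} (hs : 0 < s) : (Ω.differences s).Finite := by
  refine (Set.Finite.biUnion (finite_patches Ω hs) (t := id) ?_).subset ?_
  · rintro _ ⟨⟨ω, x⟩, rfl⟩
    refine (Set.Finite.image (fun y : ω.1.carrier => (y : Euc d) - x)
      (finite_inter ω (Metric.isBounded_closedBall (x := x.1) (r := s)))).subset fun z hz => ?_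
    rw [id, mem_patch] at hz
    exact ⟨⟨x + z, hz.1⟩, by simpa using hz.2, by simp⟩
  · rintro e ⟨he, ω, x, hx, hxe⟩
    exact mem_biUnion ⟨⟨ω, ⟨x, hx⟩⟩, rfl⟩ (mem_patch.2 ⟨hxe, he⟩)

theorem exists_pos_le_dist_of_finite {D : Set (Euc d)} (hD : D.Finite) :
    ∃ η : ℝ, 0 < η ∧ ∀ x ∈ D, ∀ y ∈ D, x ≠ y → η ≤ dist x y := by
  have := hD.to_subtype
  obtain ⟨η, hη, hsep⟩ := Set.relatively_discrete_of_finite (s := D)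
  have hm : min η 1 ≠ ∞ := ne_top_of_le_ne_top ENNReal.one_ne_top (min_le_right _ _)
  refine ⟨(min η 1).toReal, ENNReal.toReal_pos (lt_min hη one_pos).ne' hm, fun x hx y hy hxy => ?_⟩
  have h := (min_le_left η 1).trans (hsep x hx y hy hxy)
  rw [edist_dist] at h
  exact ENNReal.toReal_le_of_le_ofReal dist_nonneg h

/-- A set of the system that is close to `ω₀` agrees with `ω₀` on a large ball up to a small
translation: the finitely many difference vectors cannot be perturbed. -/
theorem eventually_patchEq (ω₀ : Ω.Point) {R δ : ℝ} (hR : 0 ≤ R) (hδ : 0 < δ) :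
    ∀ᶠ ω in 𝓝 ω₀, ∃ u : Euc d, ‖u‖ < δ ∧ PatchEq R ω ω₀ u 0 := by
  set D := Ω.differences (2 * R + 4)
  have hD : D.Finite := finite_differences Ω (by positivity)
  obtain ⟨η, hη, hsep⟩ := exists_pos_le_dist_of_finite hD
  set ε := min (min (δ / 2) (η / 3)) 1
  have hε : 0 < ε := by positivity
  have hεδ : 2 * ε ≤ δ := by
    have := (min_le_left (min (δ / 2) (η / 3)) 1).trans (min_le_left _ _)
    linarith
  have hεη : 2 * ε < η := by
    have := (min_le_left (min (δ / 2) (η / 3)) 1).trans (min_le_right _ _)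
    linarith
  have hε1 : ε ≤ 1 := min_le_right _ _
  have hS : {x : ω₀.1.carrier | (x : Euc d) ∈ Metric.closedBall 0 (R + 1)}.Finite :=
    finite_inter ω₀ Metric.isBounded_closedBall
  have H1 : ∀ᶠ ω : Ω.Point in 𝓝 ω₀, ∀ x ∈ {x : ω₀.1.carrier | (x : Euc d) ∈
      Metric.closedBall 0 (R + 1)}, (ω.1.carrier ∩ Metric.ball x ε).Nonempty :=
    (eventually_all_finite hS).2 fun x _ =>
      ((ClosedSubset.isOpen_hit Metric.isOpen_ball).preimage continuous_subtype_val).mem_nhds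
        (⟨x, x.2, Metric.mem_ball_self hε⟩ : (ω₀.1.carrier ∩ Metric.ball (x : Euc d) ε).Nonempty)
  have H2 : ∀ᶠ ω : Ω.Point in 𝓝 ω₀, ω.1.carrier ∩ (Metric.closedBall 0 (R + 1) \
      ⋃ x : ω₀.1.carrier, Metric.ball (x : Euc d) ε) = ∅ := by
    refine ((ClosedSubset.isOpen_miss ?_).preimage continuous_subtype_val).mem_nhds ?_
    · exact (isCompact_closedBall _ _).diff (isOpen_iUnion fun _ => Metric.isOpen_ball)
    · refine eq_empty_iff_forall_notMem.2 fun x hx => hx.2.2 ?_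
      exact mem_iUnion.2 ⟨⟨x, hx.1⟩, Metric.mem_ball_self hε⟩
  filter_upwards [H1, H2] with ω h1 h2
  have near : ∀ y ∈ ω.1.carrier, ‖y‖ ≤ R + 1 → ∃ x ∈ ω₀.1.carrier, dist y x < ε := by
    intro y hy hyR
    by_contra! hcon
    refine eq_empty_iff_forall_notMem.1 h2 y ⟨hy, by simpa using hyR, fun hmem => ?_⟩
    obtain ⟨x, hx⟩ := mem_iUnion.1 hmem
    exact (hcon x x.2).not_gt hx
  -- Corresponding differences in `ω` and `ω₀` are less than `η` apart, hence equal.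
  have rigid : ∀ x ∈ ω₀.1.carrier, ∀ x₀ ∈ ω₀.1.carrier, ∀ y ∈ ω.1.carrier, ∀ y₀ ∈ ω.1.carrier,
      ‖x‖ ≤ R + 2 → ‖x₀‖ ≤ R + 1 → dist y x < ε → dist y₀ x₀ < ε → ‖y‖ ≤ R + 1 →
      y - y₀ = x - x₀ := by
    intro x hx x₀ hx₀ y hy y₀ hy₀ nx nx₀ d1 d2 ny
    by_contra hne
    rw [dist_eq_norm] at d1 d2
    have n0 : ‖y₀‖ ≤ R + 2 := by
      have := norm_add_le (y₀ - x₀) x₀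
      rw [sub_add_cancel] at this
      linarith
    have m1 : y - y₀ ∈ D := ⟨(norm_sub_le _ _).trans (by linarith), ω, y₀, hy₀, by simpa using hy⟩
    have m2 : x - x₀ ∈ D := ⟨(norm_sub_le _ _).trans (by linarith), ω₀, x₀, hx₀, by simpa using hx⟩
    have h3 := hsep _ m1 _ m2 hne
    rw [dist_eq_norm, show y - y₀ - (x - x₀) = y - x - (y₀ - x₀) by abel] at h3
    linarith [norm_sub_le (y - x) (y₀ - x₀)]
  by_cases hne : ∃ x₀ ∈ ω₀.1.carrier, ‖x₀‖ ≤ R + 1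
  · obtain ⟨x₀, hx₀, hx₀R⟩ := hne
    obtain ⟨y₀, hy₀, hd⟩ := h1 ⟨x₀, hx₀⟩ (by simpa using hx₀R)
    rw [Metric.mem_ball] at hd
    have hu : ‖y₀ - x₀‖ < ε := by rwa [← dist_eq_norm]
    refine ⟨y₀ - x₀, by linarith, fun z hz => ?_⟩
    rw [zero_add]
    constructor
    · intro hzω
      have hn : ‖y₀ - x₀ + z‖ ≤ R + 1 := (norm_add_le _ _).trans (by linarith)
      obtain ⟨x, hx, hdx⟩ := near _ hzω hn
      have nx : ‖x‖ ≤ R + 2 := by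
        rw [dist_eq_norm] at hdx
        have := norm_sub_le (y₀ - x₀ + z) (y₀ - x₀ + z - x)
        rw [sub_sub_cancel] at this
        linarith
      have := rigid x hx x₀ hx₀ _ hzω y₀ hy₀ nx (by linarith) hdx hd hn
      have hzx : z = x := by
        rw [show y₀ - x₀ + z - y₀ = z - x₀ by abel] at this
        exact sub_left_injective this
      exact hzx ▸ hx
    · intro hzω
      obtain ⟨y, hy, hdy⟩ := h1 ⟨z, hzω⟩ (by simpa using hz.trans (by linarith))
      rw [Metric.mem_ball] at hdy
      have ny : ‖y‖ ≤ R + 1 := by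
        rw [dist_eq_norm] at hdy
        have := norm_add_le (y - z) z
        rw [sub_add_cancel] at this
        linarith
      have := rigid z hzω x₀ hx₀ y hy y₀ hy₀ (by linarith) (by linarith) hdy hd ny
      have hyz : y₀ - x₀ + z = y := by
        rw [sub_eq_iff_eq_add] at this
        rw [this]; abel
      exact hyz ▸ hy
  · have hne' : ∀ x ∈ ω₀.1.carrier, R + 1 < ‖x‖ := by simpa using hne
    refine ⟨0, by simpa using hδ, fun z hz => ?_⟩
    rw [zero_add]
    refine iff_of_false (fun h => ?_) fun h => by linarith [hne' z h]
    obtain ⟨x, hx, hd⟩ := near z h (by linarith)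
    rw [dist_eq_norm] at hd
    have := norm_sub_le z (z - x)
    rw [sub_sub_cancel] at this
    linarith [hne' x hx]

/-! ### Almost local functions of the points -/

/-- A function of the points of the sets in the system that depends only on the patch of some
fixed radius around the point. -/
def IsLocal (h : (ω : Ω.Point) → ω.1.carrier → ℝ) : Prop :=
  ∃ s : ℝ, 0 < s ∧ ∀ (ω ω' : Ω.Point) (x : ω.1.carrier) (x' : ω'.1.carrier),
    PatchEq s ω ω' x x' → h ω x = h ω' x'

/-- A uniform limit of local functions. -/
def IsAlmostLocal (h : (ω : Ω.Point) → ω.1.carrier → ℝ) : Prop :=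
  ∀ ε : ℝ, 0 < ε → ∃ h', IsLocal h' ∧ ∀ (ω : Ω.Point) (x : ω.1.carrier), |h ω x - h' ω x| ≤ ε

theorem IsLocal.exists_bound {h : (ω : Ω.Point) → ω.1.carrier → ℝ} (hh : IsLocal h) :
    ∃ C : ℝ, 0 ≤ C ∧ ∀ (ω : Ω.Point) (x : ω.1.carrier), |h ω x| ≤ C := by
  obtain ⟨s, hs, hloc⟩ := hh
  let p : (Σ ω : Ω.Point, ω.1.carrier) → Set (Euc d) := fun q => patch s q.1 q.2
  let g : (Σ ω : Ω.Point, ω.1.carrier) → ℝ := fun q => h q.1 q.2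
  have hf : Function.FactorsThrough g p := fun q q' hq =>
    hloc _ _ _ _ (patchEq_of_patch_eq hq)
  have hfin : (range g).Finite := by
    refine ((finite_patches Ω hs).image (Function.extend p g 0)).subset ?_
    rintro _ ⟨q, rfl⟩
    exact ⟨p q, ⟨q, rfl⟩, hf.extend_apply 0 q⟩
  obtain ⟨C, hC⟩ := hfin.isBounded.exists_norm_le
  exact ⟨max C 0, le_max_right _ _, fun ω x =>
    (hC _ ⟨⟨ω, x⟩, rfl⟩ : ‖g ⟨ω, x⟩‖ ≤ C).trans (le_max_left _ _)⟩

theorem isLocal_const (c : ℝ) : IsLocal fun (ω : Ω.Point) (_ : ω.1.carrier) => c :=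
  ⟨1, one_pos, fun _ _ _ _ _ => rfl⟩

theorem IsAlmostLocal.exists_bound {h : (ω : Ω.Point) → ω.1.carrier → ℝ}
    (hh : IsAlmostLocal h) :
    ∃ C : ℝ, 0 ≤ C ∧ ∀ (ω : Ω.Point) (x : ω.1.carrier), |h ω x| ≤ C := by
  obtain ⟨h', hl, hd⟩ := hh 1 one_pos
  obtain ⟨C, hC0, hC⟩ := hl.exists_bound
  refine ⟨C + 1, by positivity, fun ω x => ?_⟩
  have := abs_sub_abs_le_abs_sub (h ω x) (h' ω x)
  linarith [hd ω x, hC ω x]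

/-- An almost local function is exactly invariant under translations. -/
theorem IsAlmostLocal.eq_of_patchEq {h : (ω : Ω.Point) → ω.1.carrier → ℝ}
    (hh : IsAlmostLocal h) {ω ω' : Ω.Point} {x : ω.1.carrier} {x' : ω'.1.carrier}
    (hp : ∀ s, PatchEq s ω ω' x x') : h ω x = h ω' x' := by
  refine eq_of_forall_dist_le fun ε hε => ?_
  obtain ⟨h', ⟨s, _, hl⟩, hd⟩ := hh (ε / 2) (by positivity)
  have h1 := abs_le.1 (hd ω x)
  have h2 := abs_le.1 (hd ω' x')
  rw [hl _ _ _ _ (hp s)] at h1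
  rw [Real.dist_eq, abs_le]
  constructor <;> linarith

/-- The sum of a function of the points of `ω`, weighted by `f`. -/
noncomputable def weightedSum (f : Euc d → ℝ) (h : (ω : Ω.Point) → ω.1.carrier → ℝ)
    (ω : Ω.Point) : ℝ := ∑' x : ω.1.carrier, f x * h ω x

theorem exists_support_bound {f : Euc d → ℝ} (hf : HasCompactSupport f) :
    ∃ ρ : ℝ, 0 ≤ ρ ∧ ∀ x, f x ≠ 0 → ‖x‖ ≤ ρ := by
  obtain ⟨ρ, hρ⟩ := hf.isCompact.isBounded.exists_norm_le
  exact ⟨max ρ 0, le_max_right _ _, fun x hx =>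
    (hρ x (subset_tsupport f hx)).trans (le_max_left _ _)⟩

theorem finite_support_weighted {f : Euc d → ℝ} (hf : HasCompactSupport f) (ω : Ω.Point) :
    (Function.support fun x : ω.1.carrier => f x).Finite :=
  (finite_inter ω hf.isCompact.isBounded).subset fun _ hx => subset_tsupport f hx

theorem summable_weighted {f : Euc d → ℝ} (hf : HasCompactSupport f) (ω : Ω.Point)
    (h : ω.1.carrier → ℝ) : Summable fun x : ω.1.carrier => f x * h x :=
  summable_of_hasFiniteSupport ((finite_support_weighted hf ω).subset
    fun _ hx => left_ne_zero_of_mul hx)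

/-- Close to `ω₀`, the sets of the system are locally translates `ω₀ + u`, along which the weighted
sum is a continuous function of `u`. -/
theorem IsLocal.continuous_weightedSum {h : (ω : Ω.Point) → ω.1.carrier → ℝ} (hh : IsLocal h)
    {f : Euc d → ℝ} (hf : Continuous f) (hfc : HasCompactSupport f) :
    Continuous (weightedSum f h) := by
  obtain ⟨s, hs, hloc⟩ := hh
  obtain ⟨ρ, hρ0, hρ⟩ := exists_support_bound hfc
  refine continuous_iff_continuousAt.2 fun ω₀ => ?_
  let S : Set ω₀.1.carrier := {x | (x : Euc d) ∈ Metric.closedBall 0 (ρ + 1)}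
  have hS : S.Finite := finite_inter ω₀ Metric.isBounded_closedBall
  have := hS.fintype
  let G : Euc d → ℝ := fun u => ∑ x : S, f (u + x.1) * h ω₀ x.1
  have hG : Continuous G := by fun_prop
  -- If `ω` agrees with `ω₀ + u` on a large ball, then its weighted sum is `G u`.
  have key : ∀ ω u, ‖u‖ < 1 → PatchEq (ρ + 1 + s) ω ω₀ u 0 → weightedSum f h ω = G u := by
    intro ω u hu hp
    have hmem : ∀ x : S, ‖(x.1 : Euc d)‖ ≤ ρ + 1 := fun x => mem_closedBall_zero_iff.1 x.2
    let i : S → ω.1.carrier := fun x => ⟨u + x.1, (hp x.1 (by linarith [hmem x])).2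
      (by rw [zero_add]; exact x.1.2)⟩
    have hi : Function.Injective i := fun x y hxy => by
      have := congrArg Subtype.val hxy
      exact Subtype.ext (Subtype.ext (add_left_cancel this))
    have hsupp : (Function.support fun y : ω.1.carrier => f y * h ω y) ⊆ range i := by
      intro y hy
      have hy1 := hρ y (left_ne_zero_of_mul hy)
      have hn : ‖(y : Euc d) - u‖ ≤ ρ + 1 := (norm_sub_le _ _).trans (by linarith)
      have hm := (hp (y - u) (by linarith)).1 (by rw [add_sub_cancel]; exact y.2)
      rw [zero_add] at hm
      exact ⟨⟨⟨y - u, hm⟩, by simpa [S] using hn⟩, Subtype.ext (add_sub_cancel _ _)⟩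
    rw [weightedSum, ← hi.tsum_eq hsupp, tsum_fintype]
    refine Finset.sum_congr rfl fun x _ => ?_
    have hpx := hp.shift (r := s) (e := x.1) (by linarith [hmem x])
    rw [zero_add] at hpx
    rw [hloc ω ω₀ (i x) x.1 hpx]
  have hG0 : weightedSum f h ω₀ = G 0 := key ω₀ 0 (by simp) fun z _ => Iff.rfl
  rw [ContinuousAt, hG0]
  intro W hW
  obtain ⟨δ, hδ, hδW⟩ := Metric.mem_nhds_iff.1 (hG.continuousAt.preimage_mem_nhds hW)
  refine mem_map.2 ?_
  filter_upwards [eventually_patchEq ω₀ (R := ρ + 1 + s) (δ := min δ 1) (by positivity)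
    (by positivity)] with ω ⟨u, hu, hp⟩
  rw [mem_preimage, key ω u (hu.trans_le (min_le_right _ _)) hp]
  exact hδW (by simpa using hu.trans_le (min_le_left _ _))

theorem abs_weightedSum_sub_le {f : Euc d → ℝ} (hfc : HasCompactSupport f)
    {h h' : (ω : Ω.Point) → ω.1.carrier → ℝ} {ω : Ω.Point} {ε : ℝ}
    (hd : ∀ x : ω.1.carrier, |h ω x - h' ω x| ≤ ε) :
    |weightedSum f h ω - weightedSum f h' ω| ≤
      weightedSum (fun x => |f x|) (fun _ _ => 1) ω * ε := by
  have hfc' : HasCompactSupport fun x => |f x| := hfc.abs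
  rw [weightedSum, weightedSum, weightedSum,
    ← (summable_weighted hfc ω _).tsum_sub (summable_weighted hfc ω _), ← tsum_mul_right,
    ← Real.norm_eq_abs]
  refine tsum_of_norm_bounded (g := fun x : ω.1.carrier => |f x| * 1 * ε)
    (((summable_weighted hfc' ω fun _ => 1).mul_right ε).hasSum) fun x => ?_
  rw [← mul_sub, norm_mul, mul_one]
  exact mul_le_mul_of_nonneg_left (hd x) (abs_nonneg _)

theorem IsAlmostLocal.continuous_weightedSum {h : (ω : Ω.Point) → ω.1.carrier → ℝ}
    (hh : IsAlmostLocal h) {f : Euc d → ℝ} (hf : Continuous f) (hfc : HasCompactSupport f) :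
    Continuous (weightedSum f h) := by
  have h1 : Continuous (weightedSum (Ω := Ω) (fun x => |f x|) fun _ _ => 1) :=
    (isLocal_const 1).continuous_weightedSum hf.abs hfc.abs
  obtain ⟨M, hM⟩ := isCompact_univ.exists_bound_of_continuousOn h1.continuousOn
  refine continuous_of_uniform_approx_of_continuous fun U hU => ?_
  obtain ⟨ε, hε, hεU⟩ := Metric.mem_uniformity_dist.1 hU
  obtain ⟨h', hl, hd⟩ := hh (ε / (|M| + 1)) (by positivity)
  refine ⟨weightedSum f h', hl.continuous_weightedSum hf hfc, fun ω => hεU ?_⟩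
  rw [Real.dist_eq]
  refine (abs_weightedSum_sub_le hfc (hd ω)).trans_lt ?_
  have hMω := (le_abs_self _).trans ((hM ω (mem_univ _)).trans (le_abs_self M))
  rw [mul_div_assoc', div_lt_iff₀ (by positivity)]
  nlinarith

/-! ### Averages over van Hove sequences -/

/-- The points of `ω` in a bounded set. -/
noncomputable def pointsIn (ω : Ω.Point) {S : Set (Euc d)} (hS : Bornology.IsBounded S) :
    Finset ω.1.carrier := (finite_inter ω hS).toFinset

theorem mem_pointsIn {ω : Ω.Point} {S : Set (Euc d)} {hS : Bornology.IsBounded S}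
    {x : ω.1.carrier} : x ∈ pointsIn ω hS ↔ (x : Euc d) ∈ S := by
  simp [pointsIn]

/-- By uniform discreteness, the number of points in a set is controlled by the volume of its
neighbourhood. -/
theorem exists_card_pointsIn_le (ω : Ω.Point) : ∃ C : ℝ, 0 ≤ C ∧ ∀ (S : Set (Euc d))
    (hS : Bornology.IsBounded S),
      ((pointsIn ω hS).card : ℝ) ≤ C * volume.real (Metric.thickening 1 S) := by
  obtain ⟨D, hD⟩ := Ω.isDelone _ ω.2
  obtain ⟨r, hr, huniq⟩ := D.subset_ball_singleton
  have hr' : (0 : ℝ) < min (r : ℝ) 1 := lt_min hr one_pos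
  set q := min (r : ℝ) 1
  have hv : 0 < volume.real (Metric.ball (0 : Euc d) q) :=
    ENNReal.toReal_pos (Metric.measure_ball_pos _ _ hr').ne' measure_ball_lt_top.ne
  refine ⟨(volume.real (Metric.ball (0 : Euc d) q))⁻¹, by positivity, fun S hS => ?_⟩
  rw [inv_mul_eq_div, le_div_iff₀ hv]
  have hdisj : (pointsIn ω hS : Set ω.1.carrier).PairwiseDisjoint
      fun x => Metric.ball (x : Euc d) q := by
    intro x _ y _ hxy
    refine disjoint_left.2 fun z hzx hzy => hxy (Subtype.ext ?_)
    have hx : (x : Euc d) ∈ D.carrier := by rw [hD]; exact x.2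
    have hy : (y : Euc d) ∈ D.carrier := by rw [hD]; exact y.2
    refine huniq hx hy (z := z) ?_ ?_
    · rw [Metric.mem_ball, dist_comm]; exact (Metric.mem_ball.1 hzx).trans_le (min_le_left _ _)
    · rw [Metric.mem_ball, dist_comm]; exact (Metric.mem_ball.1 hzy).trans_le (min_le_left _ _)
  have hsub : ⋃ x ∈ pointsIn ω hS, Metric.ball (x : Euc d) q ⊆ Metric.thickening 1 S := by
    refine iUnion₂_subset fun x hx z hz => Metric.mem_thickening_iff.2 ⟨x, mem_pointsIn.1 hx, ?_⟩
    exact (Metric.mem_ball.1 hz).trans_le (min_le_right _ _)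
  have := measureReal_mono (μ := volume) hsub hS.thickening.measure_lt_top.ne
  rw [measureReal_biUnion_finset hdisj (fun x _ => Metric.isOpen_ball.measurableSet)
    (fun x _ => measure_ball_lt_top.ne)] at this
  simpa [measureReal_def, Measure.addHaar_ball_center, Finset.sum_const] using this

theorem tendsto_card_boundary (ω : Ω.Point) {Q : ℕ → Set (Euc d)} (hQ : IsVanHove Q) {b : ℝ}
    (hb : 0 < b) : Tendsto (fun n => (volume.real (Q n))⁻¹ *
      ((pointsIn ω (isBounded_thickening_frontier (hQ.isBounded n) b)).card : ℝ))
      atTop (𝓝 0) := by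
  obtain ⟨C, hC0, hC⟩ := exists_card_pointsIn_le ω
  have h := (hQ.tendsto (1 + b) (by positivity)).const_mul C
  rw [mul_zero] at h
  refine squeeze_zero (fun n => by positivity) (fun n => ?_) h
  have hp := hQ.volume_real_pos n
  rw [inv_mul_eq_div, mul_div_assoc']
  refine div_le_div_of_nonneg_right ((hC _ _).trans ?_) hp.le
  refine mul_le_mul_of_nonneg_left (measureReal_mono (Metric.thickening_thickening_subset _ _ _)
    (volume_thickening_frontier_ne_top (hQ.isBounded n) _)) hC0

theorem weightedSum_translate {h : (ω : Ω.Point) → ω.1.carrier → ℝ} (hh : IsAlmostLocal h)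
    (f : Euc d → ℝ) (ω : Ω.Point) (t : Euc d) :
    weightedSum f h (Ω.translate (-t) ω) = ∑' x : ω.1.carrier, f (x - t) * h ω x := by
  let e : ω.1.carrier ≃ (Ω.translate (-t) ω).1.carrier :=
    { toFun := fun x => ⟨x - t, by rw [mem_translate]; simp⟩
      invFun := fun y => ⟨y + t, by
        have := y.2
        rwa [mem_translate, sub_neg_eq_add] at this⟩
      left_inv := fun x => by simp
      right_inv := fun y => by simp }
  rw [weightedSum, ← e.tsum_eq]
  refine tsum_congr fun x => ?_
  have : h (Ω.translate (-t) ω) (e x) = h ω x := hh.eq_of_patchEq fun s => by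
    have := patchEq_translate s ω (-t) x
    rwa [← sub_eq_add_neg] at this
  rw [this]
  rfl

/-- Smearing out the points of `ω` with the kernel `f` changes a sum over the points in `S` only by
contributions of points close to the boundary of `S`. -/
theorem abs_integral_weightedSum_sub_le {h : (ω : Ω.Point) → ω.1.carrier → ℝ}
    (hh : IsAlmostLocal h) {C : ℝ} (hC0 : 0 ≤ C)
    (hC : ∀ (ω : Ω.Point) (x : ω.1.carrier), |h ω x| ≤ C)
    {f : Euc d → ℝ} (hf : Continuous f) (hfc : HasCompactSupport f) (hf0 : 0 ≤ f)
    (hf1 : ∫ x, f x = 1) {ρ : ℝ} (hρ0 : 0 ≤ ρ) (hρ : ∀ x, f x ≠ 0 → ‖x‖ ≤ ρ) (ω : Ω.Point)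
    {S : Set (Euc d)} (hS : Bornology.IsBounded S) :
    |(∫ t in closure S, weightedSum f h (Ω.translate (-t) ω)) - ∑ x ∈ pointsIn ω hS, h ω x| ≤
      C * (pointsIn ω (isBounded_thickening_frontier hS (ρ + 1))).card := by
  classical
  have hK : IsCompact (closure S) := hS.isCompact_closure
  set T := Metric.thickening (ρ + 1) (frontier S)
  set W := pointsIn ω (hS.thickening (δ := ρ + 1))
  have hsum : ∀ t ∈ closure S, weightedSum f h (Ω.translate (-t) ω) =
      ∑ x ∈ W, h ω x * f (x - t) := by
    intro t ht
    rw [weightedSum_translate hh, tsum_eq_sum (s := W)]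
    · exact Finset.sum_congr rfl fun x _ => mul_comm _ _
    · intro x hx
      by_contra hne
      refine hx (mem_pointsIn.2 ?_)
      rw [← Metric.thickening_closure]
      refine Metric.mem_thickening_iff.2 ⟨t, ht, ?_⟩
      rw [dist_eq_norm]
      linarith [hρ _ (left_ne_zero_of_mul hne)]
  have hfi : ∀ x : Euc d, IntegrableOn (fun t => f (x - t)) (closure S) := fun x =>
    ContinuousOn.integrableOn_compact hK (by fun_prop)
  have hfi' : ∀ x : Euc d, Integrable fun t => f (x - t) := fun x =>
    (hf.integrable_of_hasCompactSupport hfc).comp_sub_left x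
  have hint : ∀ x : Euc d, ∫ t, f (x - t) = 1 := fun x => by
    rw [integral_sub_left_eq_self f volume x, hf1]
  rw [setIntegral_congr_fun isClosed_closure.measurableSet hsum,
    integral_finsetSum W fun x _ => (hfi x).const_mul (h ω x)]
  have hsub : ∑ x ∈ pointsIn ω hS, h ω x = ∑ x ∈ W, h ω x * if (x : Euc d) ∈ S then 1 else 0 := by
    simp only [mul_ite, mul_one, mul_zero]
    rw [← Finset.sum_filter]
    refine Finset.sum_congr (Finset.ext fun x => ?_) fun _ _ => rfl
    rw [Finset.mem_filter, mem_pointsIn, mem_pointsIn]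
    exact ⟨fun hx => ⟨Metric.self_subset_thickening (by positivity) S hx, hx⟩, fun hx => hx.2⟩
  rw [hsub, ← Finset.sum_sub_distrib]
  have hterm : ∀ x ∈ W, |(∫ t in closure S, h ω x * f (x - t)) -
      h ω x * (if (x : Euc d) ∈ S then 1 else 0)| ≤ if (x : Euc d) ∈ T then C else 0 := by
    intro x _
    rw [integral_const_mul, ← mul_sub, abs_mul]
    have h0 : 0 ≤ ∫ t in closure S, f (x - t) := integral_nonneg fun t => by simpa using hf0 (x - t)
    have h1 : ∫ t in closure S, f (x - t) ≤ 1 := by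
      rw [← hint x]
      exact setIntegral_le_integral (hfi' x) (ae_of_all _ fun t => by simpa using hf0 (x - t))
    by_cases hT : (x : Euc d) ∈ T
    · rw [if_pos hT]
      have : |(∫ t in closure S, f (x - t)) - if (x : Euc d) ∈ S then 1 else 0| ≤ 1 := by
        rw [abs_le]
        split_ifs <;> constructor <;> linarith
      calc _ ≤ C * 1 := mul_le_mul (hC _ _) this (abs_nonneg _) hC0
        _ = C := mul_one C
    · rw [if_neg hT]
      have hclose : ∀ t, f (x - t) ≠ 0 → dist (x : Euc d) t < ρ + 1 := fun t ht => by
        rw [dist_eq_norm]; linarith [hρ _ ht]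
      have : (∫ t in closure S, f (x - t)) - (if (x : Euc d) ∈ S then (1 : ℝ) else 0) = 0 := by
        by_cases hx : (x : Euc d) ∈ S
        · rw [if_pos hx, setIntegral_eq_integral_of_forall_compl_eq_zero, hint, sub_self]
          intro t ht
          by_contra hne
          exact hT (mem_thickening_frontier
            (fun hiff => ht (subset_closure (hiff.1 hx))) (hclose t hne))
        · rw [if_neg hx, sub_zero]
          refine setIntegral_eq_zero_of_forall_eq_zero fun t ht => ?_
          by_contra hne
          rw [closure_eq_self_union_frontier] at ht
          rcases ht with ht | ht
          · exact hT (mem_thickening_frontier (fun hiff => hx (hiff.2 ht)) (hclose t hne))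
          · exact hT (Metric.mem_thickening_iff.2 ⟨t, ht, hclose t hne⟩)
      rw [this]; simp
  refine (Finset.abs_sum_le_sum_abs _ _).trans ((Finset.sum_le_sum hterm).trans ?_)
  rw [← Finset.sum_filter, Finset.sum_const, nsmul_eq_mul, mul_comm]
  refine mul_le_mul_of_nonneg_left ?_ hC0
  exact_mod_cast Finset.card_le_card fun x hx => mem_pointsIn.2 (Finset.mem_filter.1 hx).2

/-- Averages of an almost local function over the points in a van Hove sequence converge, to the
mean of its weighted sums. -/
theorem tendsto_average_pointsIn (hΩ : Ω.IsUniquelyErgodic) {μ : Measure Ω.Point}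
    (hμ : Ω.IsInvariantProbability μ) {Q : ℕ → Set (Euc d)} (hQ : IsVanHove Q) (ω : Ω.Point)
    {h : (ω : Ω.Point) → ω.1.carrier → ℝ} (hh : IsAlmostLocal h)
    {f : Euc d → ℝ} (hf : Continuous f) (hfc : HasCompactSupport f) (hf0 : 0 ≤ f)
    (hf1 : ∫ x, f x = 1) :
    Tendsto (fun n => (volume.real (Q n))⁻¹ * ∑ x ∈ pointsIn ω (hQ.isBounded n), h ω x)
      atTop (𝓝 (∫ ω', weightedSum f h ω' ∂μ)) := by
  obtain ⟨ρ, hρ0, hρ⟩ := exists_support_bound hfc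
  obtain ⟨C, hC0, hC⟩ := hh.exists_bound
  have h1 := tendsto_orbit_average hΩ hμ hQ ω (hh.continuous_weightedSum hf hfc)
  have h2 : Tendsto (fun n => (volume.real (Q n))⁻¹ *
      (∫ t in closure (Q n), weightedSum f h (Ω.translate (-t) ω)) -
      (volume.real (Q n))⁻¹ * ∑ x ∈ pointsIn ω (hQ.isBounded n), h ω x) atTop (𝓝 0) := by
    have h3 := (tendsto_card_boundary ω hQ (b := ρ + 1) (by positivity)).const_mul C
    rw [mul_zero] at h3
    refine squeeze_zero_norm (fun n => ?_) h3
    have hp := hQ.volume_real_pos n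
    rw [← mul_sub, norm_mul, Real.norm_of_nonneg (by positivity), mul_left_comm]
    exact mul_le_mul_of_nonneg_left
      (abs_integral_weightedSum_sub_le hh hC0 hC hf hfc hf0 hf1 hρ0 hρ ω (hQ.isBounded n))
      (by positivity)
  simpa using h1.sub h2

/-! ### Finite range operators -/

theorem inner_delta (ω : Ω.Point) (x : ω.1.carrier) (v : Ell2 ω) :
    inner ℂ (delta ω x) v = v x := by
  classical
  simp [delta, lp.inner_single_left]

theorem norm_delta (ω : Ω.Point) (x : ω.1.carrier) : ‖delta ω x‖ = 1 := by
  classical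
  simp [delta, lp.norm_single]

theorem delta_apply_self (ω : Ω.Point) (x : ω.1.carrier) : delta ω x x = 1 := by
  classical
  simp [delta]

theorem delta_apply_of_ne (ω : Ω.Point) {x y : ω.1.carrier} (h : y ≠ x) : delta ω x y = 0 := by
  classical
  simp [delta, h]

theorem matrixElement_eq (A : Ω.OperatorFamily) (ω : Ω.Point) (x y : ω.1.carrier) :
    matrixElement A ω x y = A ω (delta ω x) y := inner_delta ω y _

theorem hasSum_delta (ω : Ω.Point) (v : Ell2 ω) :
    HasSum (fun x : ω.1.carrier => v x • delta ω x) v := by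
  classical
  have h := lp.hasSum_single (p := 2) (by norm_num) v
  convert h using 2 with x
  rw [delta, ← lp.single_smul, smul_eq_mul, mul_one]

theorem hasSum_apply (ω : Ω.Point) (T : Ell2 ω →L[ℂ] Ell2 ω) (v : Ell2 ω) (y : ω.1.carrier) :
    HasSum (fun x : ω.1.carrier => v x * T (delta ω x) y) (T v y) := by
  have h := (innerSL ℂ (delta ω y)).hasSum (T.hasSum (hasSum_delta ω v))
  simpa [inner_delta, inner_smul_right] using h

theorem norm_apply_le (ω : Ω.Point) (v : Ell2 ω) (x : ω.1.carrier) : ‖v x‖ ≤ ‖v‖ :=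
  lp.norm_apply_le_norm (by norm_num) v x

/-- A sum over the points of `ω` close to `x`, indexed by the difference vectors instead. This makes
sums for different `ω` comparable term by term. -/
theorem tsum_eq_sum_shift (ω : Ω.Point) (x : ω.1.carrier) (D : Finset (Euc d))
    (g : ω.1.carrier → ℂ) (hg : ∀ z, g z ≠ 0 → (z : Euc d) - x ∈ D) :
    ∑' z, g z = ∑ e ∈ D, open Classical in
      if h : (x : Euc d) + e ∈ ω.1.carrier then g ⟨x + e, h⟩ else 0 := by
  classical
  let G : Euc d → ℂ := fun e => if h : (x : Euc d) + e ∈ ω.1.carrier then g ⟨x + e, h⟩ else 0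
  let i : ω.1.carrier → Euc d := fun z => z - x
  have hi : Function.Injective i := fun z z' h => Subtype.ext (sub_left_injective h)
  have hGi : ∀ z, G (i z) = g z := fun z => by
    have h : (x : Euc d) + (z - x) ∈ ω.1.carrier := by rw [add_sub_cancel]; exact z.2
    simp only [G, i, dif_pos h]
    congr 1
    exact Subtype.ext (add_sub_cancel _ _)
  have hGx : ∀ e, G e ≠ 0 → ∃ z, i z = e := fun e he => by
    by_cases h : (x : Euc d) + e ∈ ω.1.carrier
    · exact ⟨⟨x + e, h⟩, add_sub_cancel_left _ _⟩
    · simp [G, h] at he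
  rw [← tsum_congr hGi, hi.tsum_eq fun e he => hGx e he, tsum_eq_sum (s := D)]
  intro e he
  by_contra hne
  obtain ⟨z, rfl⟩ := hGx e hne
  exact he (hg z (by rwa [hGi] at hne))

/-- `A` has finite range with the radius `s`, in terms of agreement of patches. -/
structure HasRange (A : Ω.OperatorFamily) (s : ℝ) : Prop where
  pos : 0 < s
  eq_zero : ∀ (ω : Ω.Point) (x y : ω.1.carrier), s ≤ dist (x : Euc d) y → A ω (delta ω x) y = 0
  eq_of_patchEq : ∀ (ω ω' : Ω.Point) (x y : ω.1.carrier) (x' y' : ω'.1.carrier),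
    (y : Euc d) - x = y' - x' → PatchEq s ω ω' x x' →
      A ω (delta ω x) y = A ω' (delta ω' x') y'

theorem isFiniteRange_iff {A : Ω.OperatorFamily} : IsFiniteRange A ↔ ∃ s, HasRange A s := by
  simp only [IsFiniteRange, matrixElement_eq]
  constructor
  · rintro ⟨s, hs, h1, h2⟩
    refine ⟨s, hs, h1, fun ω ω' x y x' y' hxy hp => ?_⟩
    have hx : (x : Euc d) = x' + (x - x') := by abel
    have hy : (y : Euc d) = y' + (x - x') := by rw [sub_eq_iff_eq_add.1 hxy]; abel
    have := h2 ω ω' (x - x') x' y' (by rw [← hx]; exact x.2) (by rw [← hy]; exact y.2)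
      (by rw [← hx]; exact image_eq_of_patchEq hx hp)
    have ex : (⟨x' + (x - x'), by rw [← hx]; exact x.2⟩ : ω.1.carrier) = x := Subtype.ext hx.symm
    have ey : (⟨y' + (x - x'), by rw [← hy]; exact y.2⟩ : ω.1.carrier) = y := Subtype.ext hy.symm
    rwa [ex, ey] at this
  · rintro ⟨s, hs, h1, h2⟩
    exact ⟨s, hs, h1, fun ω ω' t x y hx hy h =>
      h2 ω ω' ⟨x + t, hx⟩ ⟨y + t, hy⟩ x y (by simp) (patchEq_of_image_eq h)⟩

namespace HasRange

variable {A B : Ω.OperatorFamily} {s s' : ℝ}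

theorem mono (h : HasRange A s) (hs : s ≤ s') : HasRange A s' where
  pos := h.pos.trans_le hs
  eq_zero := fun ω x y hd => h.eq_zero ω x y (hs.trans hd)
  eq_of_patchEq := fun ω ω' x y x' y' hxy hp => h.eq_of_patchEq ω ω' x y x' y' hxy (hp.mono hs)

theorem add (hA : HasRange A s) (hB : HasRange B s') : HasRange (A + B) (max s s') := by
  have hA' := hA.mono (le_max_left s s')
  have hB' := hB.mono (le_max_right s s')
  refine ⟨hA'.pos, fun ω x y hd => ?_, fun ω ω' x y x' y' hxy hp => ?_⟩
  · change A ω (delta ω x) y + B ω (delta ω x) y = 0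
    rw [hA'.eq_zero ω x y hd, hB'.eq_zero ω x y hd, add_zero]
  · change A ω (delta ω x) y + B ω (delta ω x) y = A ω' (delta ω' x') y' + B ω' (delta ω' x') y'
    rw [hA'.eq_of_patchEq ω ω' x y x' y' hxy hp, hB'.eq_of_patchEq ω ω' x y x' y' hxy hp]

theorem scalar (c : ℝ) : HasRange (algebraMap ℝ Ω.OperatorFamily c) 1 := by
  have h : ∀ (ω : Ω.Point) (x y : ω.1.carrier),
      algebraMap ℝ Ω.OperatorFamily c ω (delta ω x) y = (c : ℂ) * delta ω x y := fun ω x y => by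
    rw [Algebra.algebraMap_eq_smul_one]
    change (c • delta ω x) y = _
    simp
  refine ⟨one_pos, fun ω x y hd => ?_, fun ω ω' x y x' y' hxy _ => ?_⟩
  · have : y ≠ x := by
      rintro rfl
      rw [dist_self] at hd
      linarith
    rw [h, delta_apply_of_ne ω this, mul_zero]
  · rw [h, h]
    have hiff : y = x ↔ y' = x' := by
      rw [← Subtype.coe_inj, ← Subtype.coe_inj, ← sub_eq_zero, hxy, sub_eq_zero]
    by_cases hyx : y = x
    · rw [hyx, hiff.1 hyx, delta_apply_self, delta_apply_self]
    · rw [delta_apply_of_ne ω hyx, delta_apply_of_ne ω' (mt hiff.2 hyx)]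

/-- The matrix elements of the product from `x` involve the patches of `ω` around points at distance
at most `s'` from `x`. -/
theorem mul (hA : HasRange A s) (hB : HasRange B s') : HasRange (A * B) (s + s') := by
  classical
  have hD := finite_differences Ω hB.pos
  have hsum : ∀ (ω : Ω.Point) (x y : ω.1.carrier), (A * B) ω (delta ω x) y =
      ∑ e ∈ hD.toFinset, if h : (x : Euc d) + e ∈ ω.1.carrier then
        B ω (delta ω x) ⟨x + e, h⟩ * A ω (delta ω ⟨x + e, h⟩) y else 0 := fun ω x y => by
    change A ω (B ω (delta ω x)) y = _
    rw [← (hasSum_apply ω (A ω) (B ω (delta ω x)) y).tsum_eq]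
    convert tsum_eq_sum_shift ω x hD.toFinset _ fun z hz => ?_
    rw [hD.mem_toFinset]
    refine ⟨?_, ω, x, x.2, by rw [add_sub_cancel]; exact z.2⟩
    by_contra! hcon
    refine left_ne_zero_of_mul hz (hB.eq_zero ω x z ?_)
    rw [dist_comm, dist_eq_norm]
    exact hcon.le
  refine ⟨add_pos hA.pos hB.pos, fun ω x y hd => ?_, fun ω ω' x y x' y' hxy hp => ?_⟩
  · rw [hsum]
    refine Finset.sum_eq_zero fun e he => ?_
    have hes := (hD.mem_toFinset.1 he).1
    split_ifs with h
    · rw [hA.eq_zero ω ⟨x + e, h⟩ y, mul_zero]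
      have h1 := dist_triangle (x : Euc d) (x + e) y
      have h2 : dist (x : Euc d) (x + e) = ‖e‖ := by simp
      change s ≤ dist ((x : Euc d) + e) y
      linarith
    · rfl
  · rw [hsum, hsum]
    refine Finset.sum_congr rfl fun e he => ?_
    have hes := (hD.mem_toFinset.1 he).1
    have hiff := hp e (by linarith [hA.pos])
    by_cases h : (x : Euc d) + e ∈ ω.1.carrier
    · rw [dif_pos h, dif_pos (hiff.1 h)]
      congr 1
      · exact hB.eq_of_patchEq ω ω' x ⟨x + e, h⟩ x' ⟨x' + e, hiff.1 h⟩ (by simp)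
          (hp.mono (by linarith [hA.pos]))
      · refine hA.eq_of_patchEq ω ω' ⟨x + e, h⟩ y ⟨x' + e, hiff.1 h⟩ y' ?_
          (hp.shift (by linarith))
        change (y : Euc d) - (x + e) = y' - (x' + e)
        rw [← sub_sub, hxy, sub_sub]
    · rw [dif_neg h, dif_neg (mt hiff.2 h)]

/-- By finite local complexity, a finite range family has finitely many matrix elements. -/
theorem exists_entry_bound (hA : HasRange A s) :
    ∃ C : ℝ, 0 ≤ C ∧ ∀ (ω : Ω.Point) (x y : ω.1.carrier), ‖A ω (delta ω x) y‖ ≤ C := by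
  let I := {q : Σ ω : Ω.Point, ω.1.carrier × ω.1.carrier // ‖(q.2.2 : Euc d) - q.2.1‖ ≤ s}
  let p : I → Set (Euc d) × Euc d := fun q => (patch s q.1.1 q.1.2.1, q.1.2.2 - q.1.2.1)
  let g : I → ℂ := fun q => A q.1.1 (delta q.1.1 q.1.2.1) q.1.2.2
  have hf : Function.FactorsThrough g p := fun q q' hq =>
    hA.eq_of_patchEq _ _ _ _ _ _ (congrArg Prod.snd hq) (patchEq_of_patch_eq (congrArg Prod.fst hq))
  have hp : (range p).Finite := by
    refine ((finite_patches Ω hA.pos).prod (finite_differences Ω hA.pos)).subset ?_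
    rintro _ ⟨⟨⟨ω, x, y⟩, hq⟩, rfl⟩
    exact ⟨⟨⟨ω, x⟩, rfl⟩, hq, ω, x, x.2, by simp [p]⟩
  have hfin : (range g).Finite := by
    refine (hp.image (Function.extend p g 0)).subset ?_
    rintro _ ⟨q, rfl⟩
    exact ⟨p q, ⟨q, rfl⟩, hf.extend_apply 0 q⟩
  obtain ⟨C, hC⟩ := hfin.isBounded.exists_norm_le
  refine ⟨max C 0, le_max_right _ _, fun ω x y => ?_⟩
  by_cases h : ‖(y : Euc d) - x‖ ≤ s
  · exact (hC _ ⟨⟨⟨ω, x, y⟩, h⟩, rfl⟩ : ‖g ⟨⟨ω, x, y⟩, h⟩‖ ≤ C).trans (le_max_left _ _)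
  · rw [hA.eq_zero ω x y, norm_zero]
    · exact le_max_right _ _
    · rw [dist_comm, dist_eq_norm]
      exact (not_le.1 h).le

/-- Schur's test: bounded matrix elements and boundedly many of them in each row and column. -/
theorem exists_norm_bound (hA : HasRange A s) : ∃ M : ℝ, 0 ≤ M ∧ ∀ ω, ‖A ω‖ ≤ M := by
  classical
  obtain ⟨C, hC0, hC⟩ := hA.exists_entry_bound
  have hD := finite_differences Ω hA.pos
  set D := hD.toFinset
  refine ⟨D.card * C, by positivity, fun ω => ContinuousLinearMap.opNorm_le_bound _ (by positivity)
    fun v => ?_⟩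
  let u : Euc d → ω.1.carrier → ℝ := fun e y =>
    if h : (y : Euc d) + e ∈ ω.1.carrier then ‖v ⟨y + e, h⟩‖ else 0
  have hentry : ∀ y, ‖A ω v y‖ ≤ ∑ e ∈ D, C * u e y := fun y => by
    rw [← (hasSum_apply ω (A ω) v y).tsum_eq, tsum_eq_sum_shift ω y D _ fun z hz => ?_]
    · refine (norm_sum_le _ _).trans (Finset.sum_le_sum fun e _ => ?_)
      by_cases h : (y : Euc d) + e ∈ ω.1.carrier
      · simp only [u, dif_pos h, norm_mul]
        rw [mul_comm]
        exact mul_le_mul_of_nonneg_right (hC _ _ _) (norm_nonneg _)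
      · simp [u, h]
    · rw [hD.mem_toFinset]
      refine ⟨?_, ω, y, y.2, by rw [add_sub_cancel]; exact z.2⟩
      by_contra! hcon
      exact right_ne_zero_of_mul hz (hA.eq_zero ω z y (by rw [dist_eq_norm]; exact hcon.le))
  have hsq : ∀ S : Finset ω.1.carrier, ∑ x ∈ S, ‖v x‖ ^ 2 ≤ ‖v‖ ^ 2 := fun S => by
    have := lp.sum_rpow_le_norm_rpow (p := 2) (by norm_num) v S
    simpa using this
  have hu : ∀ e, ∀ Y : Finset ω.1.carrier, ∑ y ∈ Y, u e y ^ 2 ≤ ‖v‖ ^ 2 := fun e Y => by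
    let i : {y // y ∈ Y.filter fun y : ω.1.carrier => (y : Euc d) + e ∈ ω.1.carrier} →
        ω.1.carrier := fun y => ⟨y.1 + e, (Finset.mem_filter.1 y.2).2⟩
    have hi : Function.Injective i := fun y y' h =>
      Subtype.ext (Subtype.ext (add_right_cancel (congrArg Subtype.val h)))
    calc ∑ y ∈ Y, u e y ^ 2
        = ∑ y ∈ Y.filter fun y : ω.1.carrier => (y : Euc d) + e ∈ ω.1.carrier, u e y ^ 2 := by
          rw [Finset.sum_filter_of_ne]
          intro y _ hne
          by_contra h
          simp [u, h] at hne
      _ = ∑ y, ‖v (i y)‖ ^ 2 := by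
          rw [← Finset.sum_coe_sort]
          refine Finset.sum_congr rfl fun y _ => ?_
          simp only [u, dif_pos (Finset.mem_filter.1 y.2).2, i]
      _ = ∑ x ∈ Finset.univ.image i, ‖v x‖ ^ 2 := by
          rw [Finset.sum_image fun y _ y' _ h => hi h]
      _ ≤ ‖v‖ ^ 2 := hsq _
  refine lp.norm_le_of_forall_sum_le (p := 2) (by norm_num) (by positivity) fun Y => ?_
  have hconv : ∀ y, ‖A ω v y‖ ^ 2 ≤ D.card * ∑ e ∈ D, C ^ 2 * u e y ^ 2 := fun y => by
    calc ‖A ω v y‖ ^ 2 ≤ (∑ e ∈ D, C * u e y) ^ 2 :=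
          pow_le_pow_left₀ (norm_nonneg _) (hentry y) 2
      _ ≤ D.card * ∑ e ∈ D, (C * u e y) ^ 2 := sq_sum_le_card_mul_sum_sq
      _ = _ := by simp only [mul_pow]
  have : ∑ y ∈ Y, ‖A ω v y‖ ^ 2 ≤ (D.card * C * ‖v‖) ^ 2 := by
    calc ∑ y ∈ Y, ‖A ω v y‖ ^ 2 ≤ ∑ y ∈ Y, D.card * ∑ e ∈ D, C ^ 2 * u e y ^ 2 :=
          Finset.sum_le_sum fun y _ => hconv y
      _ = D.card * ∑ e ∈ D, C ^ 2 * ∑ y ∈ Y, u e y ^ 2 := by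
          rw [← Finset.mul_sum, Finset.sum_comm]
          simp only [Finset.mul_sum]
      _ ≤ D.card * ∑ e ∈ D, C ^ 2 * ‖v‖ ^ 2 := by
          gcongr with e _
          exact hu e Y
      _ = (D.card * C * ‖v‖) ^ 2 := by
          rw [Finset.sum_const, nsmul_eq_mul]; ring
  simpa using this

end HasRange

end DDSF

/-! ### Functional calculus in the tight binding algebra -/

section Calculus

variable {H : Type*} [NormedAddCommGroup H] [InnerProductSpace ℂ H] [CompleteSpace H]

/-- The continuous functional calculus `φ(T)`, stated for an abstract Hilbert space: on the concrete
spaces `ℓ²(ω)`, instance search does not find the calculus. -/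
noncomputable def opCfc (φ : ℝ → ℝ) (T : H →L[ℂ] H) : H →L[ℂ] H := cfc φ T

theorem abs_le_of_mem_spectrum {T : H →L[ℂ] H} {M : ℝ} (hM : ‖T‖ ≤ M) {x : ℝ}
    (hx : x ∈ spectrum ℝ T) : |x| ≤ M := by
  have h := spectrum.norm_le_norm_mul_of_mem hx
  have h1 : ‖(1 : H →L[ℂ] H)‖ ≤ 1 := ContinuousLinearMap.norm_id_le
  rw [Real.norm_eq_abs] at h
  nlinarith [norm_nonneg T]

theorem norm_opCfc_le {T : H →L[ℂ] H} {M : ℝ} (hM : ‖T‖ ≤ M)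
    {φ : ℝ → ℝ} {C : ℝ} (hC0 : 0 ≤ C) (hC : ∀ x, |x| ≤ M → |φ x| ≤ C) : ‖opCfc φ T‖ ≤ C :=
  norm_cfc_le hC0 fun x hx => hC x (abs_le_of_mem_spectrum hM hx)

theorem norm_opCfc_sub_aeval_le {T : H →L[ℂ] H} (hT : IsSelfAdjoint T) {M : ℝ} (hM : ‖T‖ ≤ M)
    {φ : ℝ → ℝ} (hφ : Continuous φ) {p : Polynomial ℝ} {ε : ℝ} (hε : 0 ≤ ε)
    (hp : ∀ x, |x| ≤ M → |p.eval x - φ x| ≤ ε) : ‖opCfc φ T - Polynomial.aeval T p‖ ≤ ε := by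
  rw [opCfc, ← cfc_polynomial p T hT,
    ← cfc_sub φ p.eval T hφ.continuousOn p.continuous.continuousOn]
  refine norm_opCfc_le hM hε fun x hx => ?_
  rw [abs_sub_comm]
  exact hp x hx

end Calculus

namespace DDSF

variable {d : ℕ} {Ω : DDSF d}

variable (Ω) in
/-- The finite range families form a real subalgebra of all operator families. -/
def finiteRangeSubalgebra : Subalgebra ℝ Ω.OperatorFamily where
  carrier := {A | IsFiniteRange A}
  mul_mem' := fun hA hB => by
    obtain ⟨s, hs⟩ := isFiniteRange_iff.1 hA
    obtain ⟨s', hs'⟩ := isFiniteRange_iff.1 hB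
    exact isFiniteRange_iff.2 ⟨_, hs.mul hs'⟩
  add_mem' := fun hA hB => by
    obtain ⟨s, hs⟩ := isFiniteRange_iff.1 hA
    obtain ⟨s', hs'⟩ := isFiniteRange_iff.1 hB
    exact isFiniteRange_iff.2 ⟨_, hs.add hs'⟩
  algebraMap_mem' := fun c => isFiniteRange_iff.2 ⟨_, HasRange.scalar c⟩

theorem exists_norm_bound {A : Ω.OperatorFamily} (hA : A ∈ Ω.tightBindingAlgebra) :
    ∃ M : ℝ, 0 ≤ M ∧ ∀ ω, ‖A ω‖ ≤ M := by
  obtain ⟨B, hB, hAB⟩ := hA 1 one_pos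
  obtain ⟨s, hs⟩ := isFiniteRange_iff.1 hB
  obtain ⟨M, hM0, hM⟩ := hs.exists_norm_bound
  refine ⟨1 + M, by positivity, fun ω => ?_⟩
  have := norm_add_le (A ω - B ω) (B ω)
  rw [sub_add_cancel] at this
  linarith [hAB ω, hM ω]

theorem IsFiniteRange.mem_tightBindingAlgebra {A : Ω.OperatorFamily} (hA : IsFiniteRange A) :
    A ∈ Ω.tightBindingAlgebra := fun ε hε => ⟨A, hA, fun ω => by simpa using hε.le⟩

/-- The algebra is closed under uniform limits. -/
theorem mem_tightBindingAlgebra_of_approx {A : Ω.OperatorFamily}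
    (h : ∀ ε : ℝ, 0 < ε → ∃ B ∈ Ω.tightBindingAlgebra, ∀ ω, ‖A ω - B ω‖ ≤ ε) :
    A ∈ Ω.tightBindingAlgebra := fun ε hε => by
  obtain ⟨B, hB, hAB⟩ := h (ε / 2) (by positivity)
  obtain ⟨B', hB', hBB'⟩ := hB (ε / 2) (by positivity)
  refine ⟨B', hB', fun ω => ?_⟩
  have := norm_add_le (A ω - B ω) (B ω - B' ω)
  rw [sub_add_sub_cancel] at this
  linarith [hAB ω, hBB' ω]

variable (Ω) in
/-- The algebra `𝒜`, bundled as a real subalgebra of all operator families. -/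
def tightBindingSubalgebra : Subalgebra ℝ Ω.OperatorFamily where
  carrier := Ω.tightBindingAlgebra
  mul_mem' := fun {A B} hA hB ε hε => by
    obtain ⟨M, hM0, hM⟩ := exists_norm_bound hA
    obtain ⟨N, hN0, hN⟩ := exists_norm_bound hB
    have hq : 0 < min (ε / (M + N + 1)) 1 := by positivity
    obtain ⟨A', hA', hAA'⟩ := hA _ hq
    obtain ⟨B', hB', hBB'⟩ := hB _ hq
    refine ⟨A' * B', (finiteRangeSubalgebra Ω).mul_mem hA' hB', fun ω => ?_⟩
    have hA'n : ‖A' ω‖ ≤ M + 1 := by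
      have := norm_sub_norm_le (A' ω) (A ω)
      rw [norm_sub_rev] at this
      linarith [hAA' ω, hM ω, min_le_right (ε / (M + N + 1)) 1]
    have e : (A * B) ω - (A' * B') ω = (A ω - A' ω) * B ω + A' ω * (B ω - B' ω) := by
      rw [Pi.mul_apply, Pi.mul_apply]; noncomm_ring
    rw [e]
    refine (norm_add_le _ _).trans ((add_le_add (norm_mul_le _ _) (norm_mul_le _ _)).trans ?_)
    set q := min (ε / (M + N + 1)) 1
    have hqε : q * (M + N + 1) ≤ ε := (le_div_iff₀ (by positivity)).1 (min_le_left _ _)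
    calc ‖A ω - A' ω‖ * ‖B ω‖ + ‖A' ω‖ * ‖B ω - B' ω‖ ≤ q * N + (M + 1) * q := by
          gcongr
          exacts [hAA' ω, hN ω, hBB' ω]
      _ = q * (M + N + 1) := by ring
      _ ≤ ε := hqε
  add_mem' := fun {A B} hA hB ε hε => by
    obtain ⟨A', hA', hAA'⟩ := hA (ε / 2) (by positivity)
    obtain ⟨B', hB', hBB'⟩ := hB (ε / 2) (by positivity)
    refine ⟨A' + B', (finiteRangeSubalgebra Ω).add_mem hA' hB', fun ω => ?_⟩
    rw [Pi.add_apply, Pi.add_apply, add_sub_add_comm]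
    linarith [norm_add_le (A ω - A' ω) (B ω - B' ω), hAA' ω, hBB' ω]
  algebraMap_mem' := fun c =>
    IsFiniteRange.mem_tightBindingAlgebra ((finiteRangeSubalgebra Ω).algebraMap_mem c)

theorem pow_mem_tightBindingAlgebra {A : Ω.OperatorFamily} (hA : A ∈ Ω.tightBindingAlgebra)
    (k : ℕ) : (fun ω => A ω ^ k) ∈ Ω.tightBindingAlgebra :=
  (tightBindingSubalgebra Ω).pow_mem hA k

theorem aeval_mem_tightBindingAlgebra {A : Ω.OperatorFamily} (hA : A ∈ Ω.tightBindingAlgebra)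
    (p : Polynomial ℝ) : (fun ω => Polynomial.aeval (A ω) p) ∈ Ω.tightBindingAlgebra := by
  have h : Polynomial.aeval A p ∈ tightBindingSubalgebra Ω := by
    rw [Polynomial.aeval_eq_sum_range]
    exact Subalgebra.sum_mem _ fun k _ =>
      Subalgebra.smul_mem _ ((tightBindingSubalgebra Ω).pow_mem hA k) _
  have e : (fun ω => Polynomial.aeval (A ω) p) = Polynomial.aeval A p := by
    funext ω
    exact Polynomial.aeval_algHom_apply (Pi.evalAlgHom ℝ _ ω) A p
  rw [e]
  exact h

theorem opCfc_mem_tightBindingAlgebra {A : Ω.OperatorFamily} (hA : A ∈ Ω.tightBindingAlgebra)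
    (hsa : ∀ ω, IsSelfAdjoint (A ω)) {φ : ℝ → ℝ} (hφ : Continuous φ) :
    (fun ω => opCfc φ (A ω)) ∈ Ω.tightBindingAlgebra := by
  obtain ⟨M, hM0, hM⟩ := exists_norm_bound hA
  refine mem_tightBindingAlgebra_of_approx fun ε hε => ?_
  obtain ⟨p, hp⟩ := exists_polynomial_near_of_continuousOn (-M) M φ hφ.continuousOn ε hε
  exact ⟨_, aeval_mem_tightBindingAlgebra hA p, fun ω => norm_opCfc_sub_aeval_le (hsa ω) (hM ω) hφ
    hε.le fun x hx => (hp x (abs_le.1 hx)).le⟩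

/-- The real parts of the diagonal matrix elements of a family of operators. For selfadjoint
families these are the matrix elements themselves. -/
noncomputable def diagonal (A : Ω.OperatorFamily) (ω : Ω.Point) (x : ω.1.carrier) : ℝ :=
  (A ω (delta ω x) x).re

theorem norm_apply_delta_le (ω : Ω.Point) (T : Ell2 ω →L[ℂ] Ell2 ω) (x : ω.1.carrier) :
    ‖T (delta ω x)‖ ≤ ‖T‖ := by
  simpa [norm_delta] using T.le_opNorm (delta ω x)

theorem isAlmostLocal_diagonal {A : Ω.OperatorFamily} (hA : A ∈ Ω.tightBindingAlgebra) :
    IsAlmostLocal (diagonal A) := fun ε hε => by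
  obtain ⟨B, hB, hAB⟩ := hA ε hε
  obtain ⟨s, hs⟩ := isFiniteRange_iff.1 hB
  refine ⟨diagonal B, ⟨s, hs.pos, fun ω ω' x x' hp => ?_⟩, fun ω x => ?_⟩
  · rw [diagonal, diagonal, hs.eq_of_patchEq ω ω' x x x' x' (by simp) hp]
  · rw [diagonal, diagonal, ← Complex.sub_re]
    refine (Complex.abs_re_le_norm _).trans ?_
    have e : A ω (delta ω x) x - B ω (delta ω x) x = (A ω - B ω) (delta ω x) x := rfl
    rw [e]
    exact (norm_apply_le ω _ x).trans ((norm_apply_delta_le ω _ x).trans (hAB ω))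

end DDSF

/-! ### Spectral measures and bounded continuous functions -/

section SpectralIntegral

/-- A continuous cutoff function which is `1` on `[-n, n]` and vanishes outside
`[-(n + 1), n + 1]`. -/
noncomputable def cutoff (n : ℕ) : C_c(ℝ, ℝ) where
  toFun := fun x => max 0 (min 1 (n + 1 - |x|))
  continuous_toFun := by fun_prop
  hasCompactSupport' := by
    refine HasCompactSupport.intro (isCompact_Icc (a := -((n : ℝ) + 1)) (b := n + 1)) fun x hx => ?_
    rw [mem_Icc, ← abs_le, not_le] at hx
    exact max_eq_left ((min_le_right _ _).trans (by linarith))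

theorem cutoff_apply (n : ℕ) (x : ℝ) : cutoff n x = max 0 (min 1 (n + 1 - |x|)) := rfl

theorem abs_cutoff_le (n : ℕ) (x : ℝ) : |cutoff n x| ≤ 1 := by
  rw [cutoff_apply, abs_of_nonneg (le_max_left _ _)]
  exact max_le zero_le_one (min_le_left _ _)

theorem cutoff_eq_one {n : ℕ} {x : ℝ} (h : |x| ≤ n) : cutoff n x = 1 := by
  rw [cutoff_apply, min_eq_left (by linarith), max_eq_right zero_le_one]

variable {H : Type*} [NormedAddCommGroup H] [InnerProductSpace ℂ H] [CompleteSpace H]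

/-- The defining property of the spectral measure extends from compactly supported to bounded
continuous functions, as the functional calculus only sees the values on the bounded spectrum. -/
theorem integral_spectralMeasure_of_bounded (T : H →L[ℂ] H) (v : H) {φ : ℝ → ℝ}
    (hφ : Continuous φ) {C : ℝ} (hC : ∀ x, |φ x| ≤ C) :
    ∫ x, φ x ∂(spectralMeasure T v) = (inner ℂ v (opCfc φ T v)).re := by
  let ψ : ℕ → C_c(ℝ, ℝ) := fun n =>
    { toFun := fun x => φ x * cutoff n x
      continuous_toFun := hφ.mul (cutoff n).continuous
      hasCompactSupport' := (cutoff n).hasCompactSupport.mul_left }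
  have hψ : ∀ n x, ψ n x = φ x * cutoff n x := fun n x => rfl
  have hC0 : 0 ≤ C := (abs_nonneg _).trans (hC 0)
  have h1 : Tendsto (fun n => ∫ x, ψ n x ∂(spectralMeasure T v)) atTop
      (𝓝 (∫ x, φ x ∂(spectralMeasure T v))) := by
    refine tendsto_integral_of_dominated_convergence (fun _ => C)
      (fun n => (ψ n).continuous.aestronglyMeasurable) (integrable_const C)
      (fun n => ae_of_all _ fun x => ?_) (ae_of_all _ fun x => ?_)
    · rw [hψ, norm_mul]
      calc ‖φ x‖ * ‖cutoff n x‖ ≤ C * 1 :=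
            mul_le_mul (hC x) (abs_cutoff_le n x) (norm_nonneg _) hC0
        _ = C := mul_one C
    · refine tendsto_const_nhds.congr' ?_
      obtain ⟨N, hN⟩ := exists_nat_ge |x|
      filter_upwards [eventually_ge_atTop N] with n hn
      rw [hψ, cutoff_eq_one (hN.trans (by exact_mod_cast hn)), mul_one]
  refine tendsto_nhds_unique h1 (tendsto_const_nhds.congr' ?_)
  obtain ⟨N, hN⟩ := exists_nat_ge ‖T‖
  filter_upwards [eventually_ge_atTop N] with n hn
  rw [integral_spectralMeasure, opCfc]
  congr 3
  refine cfc_congr fun x hx => ?_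
  rw [hψ, cutoff_eq_one (abs_le_of_mem_spectrum (hN.trans (by exact_mod_cast hn)) hx), mul_one]

end SpectralIntegral

/-! ### The density of states as a measure -/

namespace DDSF

variable {d : ℕ} {Ω : DDSF d}

/-- The points of `ω` in the support of `f`. -/
noncomputable def supportPoints (f : C_c(Euc d, ℝ)) (ω : Ω.Point) : Finset ω.1.carrier :=
  pointsIn ω f.hasCompactSupport.isCompact.isBounded

theorem apply_eq_zero_of_notMem {f : C_c(Euc d, ℝ)} {ω : Ω.Point} {x : ω.1.carrier}
    (hx : x ∉ supportPoints f ω) : f x = 0 :=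
  image_eq_zero_of_notMem_tsupport fun h => hx (mem_pointsIn.2 h)

theorem weightedSum_eq_sum (f : C_c(Euc d, ℝ)) (h : (ω : Ω.Point) → ω.1.carrier → ℝ)
    (ω : Ω.Point) : weightedSum f h ω = ∑ x ∈ supportPoints f ω, f x * h ω x :=
  tsum_eq_sum fun x hx => by rw [apply_eq_zero_of_notMem hx, zero_mul]

/-- The measure `B ↦ tr(χ_B(A_ω) M_f)`: the sum of the spectral measures at the vectors `δ_x`,
weighted by `f ≥ 0`. -/
noncomputable def localDensity (A : Ω.OperatorFamily) (f : C_c(Euc d, ℝ)) (ω : Ω.Point) :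
    Measure ℝ :=
  ∑ x ∈ supportPoints f ω, (f x).toNNReal • spectralMeasure (A ω) (delta ω x)

instance (A : Ω.OperatorFamily) (f : C_c(Euc d, ℝ)) (ω : Ω.Point) :
    IsFiniteMeasure (localDensity A f ω) := by
  unfold localDensity
  infer_instance

theorem integral_localDensity (A : Ω.OperatorFamily) {f : C_c(Euc d, ℝ)} (hf : 0 ≤ f)
    (ω : Ω.Point) {φ : ℝ → ℝ} (hφ : Continuous φ) {C : ℝ} (hC : ∀ x, |φ x| ≤ C) :
    ∫ x, φ x ∂(localDensity A f ω) =
      weightedSum f (diagonal fun ω => opCfc φ (A ω)) ω := by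
  have hint : ∀ ν : Measure ℝ, IsFiniteMeasure ν → Integrable φ ν := fun ν _ =>
    Integrable.of_bound hφ.aestronglyMeasurable C (ae_of_all _ hC)
  rw [localDensity, integral_finsetSum_measure (fun x _ => hint _ inferInstance),
    weightedSum_eq_sum]
  refine Finset.sum_congr rfl fun x _ => ?_
  rw [integral_smul_nnreal_measure, NNReal.smul_def, Real.coe_toNNReal _ (hf x), smul_eq_mul,
    integral_spectralMeasure_of_bounded _ _ hφ hC, inner_delta]
  rfl

theorem trace_spectralProjection (A : Ω.OperatorFamily) {f : C_c(Euc d, ℝ)} (hf : 0 ≤ f)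
    (ω : Ω.Point) (B : Set ℝ) :
    trace ω (spectralProjection (A ω) B ∘L mulOp f ω) = ((localDensity A f ω).real B : ℂ) := by
  have hmul : ∀ x : ω.1.carrier, mulOp f ω (delta ω x) = (f x : ℂ) • delta ω x := fun x => by
    ext y
    rw [mulOp_apply]
    change _ = (f x : ℂ) * delta ω x y
    by_cases h : y = x
    · rw [h]
    · rw [delta_apply_of_ne ω h, mul_zero, mul_zero]
  have hterm : ∀ x : ω.1.carrier,
      inner ℂ (delta ω x) ((spectralProjection (A ω) B ∘L mulOp f ω) (delta ω x)) =
        (f x : ℂ) * ((spectralMeasure (A ω) (delta ω x)).real B : ℂ) := fun x => by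
    rw [ContinuousLinearMap.comp_apply, hmul, map_smul, inner_smul_right,
      inner_spectralProjection]
  rw [trace, tsum_congr hterm, tsum_eq_sum (s := supportPoints f ω) fun x hx => by
    rw [apply_eq_zero_of_notMem hx, Complex.ofReal_zero, zero_mul]]
  have : (localDensity A f ω).real B =
      ∑ x ∈ supportPoints f ω, f x * (spectralMeasure (A ω) (delta ω x)).real B := by
    rw [localDensity, measureReal_def, Measure.finsetSum_apply, ENNReal.toReal_sum]
    · refine Finset.sum_congr rfl fun x _ => ?_
      rw [Measure.smul_apply, ENNReal.smul_def, smul_eq_mul, ENNReal.toReal_mul,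
        ENNReal.coe_toReal, Real.coe_toNNReal _ (hf x), measureReal_def]
    · intro x _
      exact measure_ne_top _ _
  rw [this]
  push_cast
  rfl

variable {A : Ω.OperatorFamily}

theorem continuous_integral_localDensity (hA : A ∈ Ω.tightBindingAlgebra)
    (hsa : ∀ ω, IsSelfAdjoint (A ω)) {f : C_c(Euc d, ℝ)} (hf : 0 ≤ f) {φ : ℝ → ℝ}
    (hφ : Continuous φ) {C : ℝ} (hC : ∀ x, |φ x| ≤ C) :
    Continuous fun ω => ∫ x, φ x ∂(localDensity A f ω) := by
  simp only [integral_localDensity A hf _ hφ hC]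
  exact (isAlmostLocal_diagonal (opCfc_mem_tightBindingAlgebra hA hsa hφ)).continuous_weightedSum
    f.continuous f.hasCompactSupport

/-- The integrals of bounded continuous functions depend continuously on `ω`, and indicator
functions of closed sets are decreasing limits of such functions. -/
theorem measurable_localDensity (hA : A ∈ Ω.tightBindingAlgebra)
    (hsa : ∀ ω, IsSelfAdjoint (A ω)) {f : C_c(Euc d, ℝ)} (hf : 0 ≤ f) :
    Measurable (localDensity A f) := by
  have hclosed : ∀ F : Set ℝ, IsClosed F → Measurable fun ω => localDensity A f ω F := by
    intro F hF
    refine measurable_of_tendsto_metrizable (fun n => ?_)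
      (tendsto_pi_nhds.2 fun ω => HasOuterApproxClosed.tendsto_lintegral_apprSeq hF
        (localDensity A f ω))
    have e : ∀ ω, ∫⁻ x, (hF.apprSeq n x : ℝ≥0∞) ∂(localDensity A f ω) =
        ENNReal.ofReal (∫ x, (hF.apprSeq n x : ℝ) ∂(localDensity A f ω)) := fun ω => by
      rw [← BoundedContinuousFunction.toReal_lintegral_coe_eq_integral, ENNReal.ofReal_toReal]
      exact (BoundedContinuousFunction.lintegral_lt_top_of_nnreal _ _).ne
    simp only [e]
    refine (ENNReal.measurable_ofReal).comp (Continuous.measurable ?_)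
    refine continuous_integral_localDensity hA hsa hf (C := 1)
      (NNReal.continuous_coe.comp (hF.apprSeq n).continuous) fun x => ?_
    rw [abs_of_nonneg (NNReal.coe_nonneg _)]
    exact_mod_cast HasOuterApproxClosed.apprSeq_apply_le_one hF n x
  refine Measurable.measure_of_isPiSystem ?_ isPiSystem_isClosed (fun F hF => hclosed F hF)
    (hclosed univ isClosed_univ)
  rw [BorelSpace.measurable_eq (α := ℝ), borel_eq_generateFrom_isClosed]

theorem exists_localDensity_bound (hA : A ∈ Ω.tightBindingAlgebra)
    (hsa : ∀ ω, IsSelfAdjoint (A ω)) {f : C_c(Euc d, ℝ)} (hf : 0 ≤ f) :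
    ∃ M : ℝ≥0, ∀ ω, localDensity A f ω univ ≤ M := by
  have h := continuous_integral_localDensity hA hsa hf (φ := fun _ => 1) continuous_const
    (C := 1) fun x => by simp
  obtain ⟨M, hM⟩ := isCompact_univ.exists_bound_of_continuousOn h.continuousOn
  refine ⟨M.toNNReal, fun ω => ?_⟩
  have := hM ω (mem_univ _)
  rw [integral_const, smul_eq_mul, mul_one, Real.norm_of_nonneg measureReal_nonneg] at this
  exact (ENNReal.le_ofReal_iff_toReal_le (measure_ne_top _ _)
    (measureReal_nonneg.trans this)).2 this

/-- The measure `B ↦ τ(χ_B(A))`, computed with the weight `f`. -/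
noncomputable def densityOfStates (μ : Measure Ω.Point) (A : Ω.OperatorFamily)
    (f : C_c(Euc d, ℝ)) : Measure ℝ := μ.bind (localDensity A f)

theorem densityOfStates_apply (μ : Measure Ω.Point) (hA : A ∈ Ω.tightBindingAlgebra)
    (hsa : ∀ ω, IsSelfAdjoint (A ω)) {f : C_c(Euc d, ℝ)} (hf : 0 ≤ f) {B : Set ℝ}
    (hB : MeasurableSet B) : densityOfStates μ A f B = ∫⁻ ω, localDensity A f ω B ∂μ :=
  Measure.bind_apply hB (measurable_localDensity hA hsa hf).aemeasurable

theorem isFiniteMeasure_densityOfStates (μ : Measure Ω.Point) [IsFiniteMeasure μ]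
    (hA : A ∈ Ω.tightBindingAlgebra) (hsa : ∀ ω, IsSelfAdjoint (A ω)) {f : C_c(Euc d, ℝ)}
    (hf : 0 ≤ f) : IsFiniteMeasure (densityOfStates μ A f) := by
  obtain ⟨M, hM⟩ := exists_localDensity_bound hA hsa hf
  refine ⟨?_⟩
  rw [densityOfStates_apply μ hA hsa hf MeasurableSet.univ]
  calc ∫⁻ ω, localDensity A f ω univ ∂μ ≤ ∫⁻ _, M ∂μ := lintegral_mono hM
    _ < ∞ := by rw [lintegral_const]; finiteness

theorem integral_densityOfStates (μ : Measure Ω.Point) [IsFiniteMeasure μ]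
    (hA : A ∈ Ω.tightBindingAlgebra) (hsa : ∀ ω, IsSelfAdjoint (A ω)) {f : C_c(Euc d, ℝ)}
    (hf : 0 ≤ f) {φ : ℝ → ℝ} (hφ : Continuous φ) {C : ℝ} (hC : ∀ x, |φ x| ≤ C) :
    ∫ x, φ x ∂(densityOfStates μ A f) =
      ∫ ω, weightedSum f (diagonal fun ω => opCfc φ (A ω)) ω ∂μ := by
  have := isFiniteMeasure_densityOfStates μ hA hsa hf
  let κ : ProbabilityTheory.Kernel Ω.Point ℝ :=
    ⟨localDensity A f, measurable_localDensity hA hsa hf⟩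
  have e : densityOfStates μ A f = κ.comp (ProbabilityTheory.Kernel.const Unit μ) () := by
    rw [← Measure.comp_eq_comp_const_apply]
    rfl
  have hint : Integrable φ (densityOfStates μ A f) :=
    Integrable.of_bound hφ.aestronglyMeasurable C (ae_of_all _ hC)
  rw [e] at hint ⊢
  rw [ProbabilityTheory.Kernel.integral_comp hint, ProbabilityTheory.Kernel.const_apply]
  exact integral_congr_ae (ae_of_all _ fun ω => integral_localDensity A hf ω hφ hC)

theorem densityOfStates_eq_tau (μ : Measure Ω.Point) [IsFiniteMeasure μ]
    (hA : A ∈ Ω.tightBindingAlgebra) (hsa : ∀ ω, IsSelfAdjoint (A ω)) {f : C_c(Euc d, ℝ)}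
    (hf : 0 ≤ f) {B : Set ℝ} (hB : MeasurableSet B) :
    Integrable (fun ω => trace ω (spectralProjection (A ω) B ∘L mulOp f ω)) μ ∧
      (((densityOfStates μ A f).real B : ℝ) : ℂ) =
        tau μ f (fun ω => spectralProjection (A ω) B) := by
  obtain ⟨M, hM⟩ := exists_localDensity_bound hA hsa hf
  have hm : Measurable fun ω => localDensity A f ω B :=
    (Measure.measurable_coe hB).comp (measurable_localDensity hA hsa hf)
  unfold tau
  simp only [trace_spectralProjection A hf]
  constructor
  · refine Integrable.ofReal (𝕜 := ℂ) (Integrable.of_bound hm.ennreal_toReal.aestronglyMeasurable M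
      (ae_of_all _ fun ω => ?_))
    refine (Real.norm_of_nonneg ENNReal.toReal_nonneg).trans_le ?_
    exact ENNReal.toReal_le_coe_of_le_coe ((measure_mono (subset_univ B)).trans (hM ω))
  · have := integral_ofReal (𝕜 := ℂ) (μ := μ) (f := fun ω => (localDensity A f ω).real B)
    refine Eq.trans ?_ this.symm
    congr 1
    rw [measureReal_def, densityOfStates_apply μ hA hsa hf hB]
    exact (integral_toReal hm.aemeasurable (ae_of_all _ fun ω => measure_lt_top _ _)).symm

/-! ### Truncation to a bounded set -/

/-- The orthogonal projection of `ℓ²(ω)` onto `ℓ²(S ∩ ω)`. -/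
noncomputable def trunc (ω : Ω.Point) {S : Set (Euc d)} (hS : Bornology.IsBounded S)
    (v : Ell2 ω) : Ell2 ω := ∑ z ∈ pointsIn ω hS, v z • delta ω z

theorem sum_smul_delta_apply (ω : Ω.Point) (F : Finset ω.1.carrier) (c : ω.1.carrier → ℂ)
    (y : ω.1.carrier) :
    (∑ z ∈ F, c z • delta ω z) y = open Classical in if y ∈ F then c y else 0 := by
  classical
  rw [lp.coeFn_sum, Finset.sum_apply]
  have : ∀ z ∈ F, (c z • delta ω z) y = if z = y then c z else 0 := fun z _ => by
    change c z * delta ω z y = _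
    split_ifs with h
    · rw [h, delta_apply_self, mul_one]
    · rw [delta_apply_of_ne ω (Ne.symm h), mul_zero]
  rw [Finset.sum_congr rfl this, Finset.sum_ite_eq']

section Trunc

variable (ω : Ω.Point) {S : Set (Euc d)} (hS : Bornology.IsBounded S)

theorem trunc_apply_of_mem (v : Ell2 ω) {y : ω.1.carrier} (hy : (y : Euc d) ∈ S) :
    trunc ω hS v y = v y := by
  rw [trunc, sum_smul_delta_apply, if_pos (mem_pointsIn.2 hy)]

theorem trunc_apply_of_notMem (v : Ell2 ω) {y : ω.1.carrier} (hy : (y : Euc d) ∉ S) :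
    trunc ω hS v y = 0 := by
  rw [trunc, sum_smul_delta_apply, if_neg fun h => hy (mem_pointsIn.1 h)]

theorem norm_trunc_le (v : Ell2 ω) : ‖trunc ω hS v‖ ≤ ‖v‖ := by
  refine lp.norm_mono (p := 2) two_ne_zero fun y => ?_
  by_cases hy : (y : Euc d) ∈ S
  · rw [trunc_apply_of_mem ω hS v hy]
  · rw [trunc_apply_of_notMem ω hS v hy, norm_zero]
    exact norm_nonneg _

theorem trunc_sub (v w : Ell2 ω) : trunc ω hS (v - w) = trunc ω hS v - trunc ω hS w := by
  rw [trunc, trunc, trunc, ← Finset.sum_sub_distrib]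
  exact Finset.sum_congr rfl fun z _ => sub_smul _ _ _

theorem trunc_eq_self {v : Ell2 ω} (hv : ∀ y : ω.1.carrier, (y : Euc d) ∉ S → v y = 0) :
    trunc ω hS v = v := by
  ext y
  by_cases hy : (y : Euc d) ∈ S
  · rw [trunc_apply_of_mem ω hS v hy]
  · rw [trunc_apply_of_notMem ω hS v hy, hv y hy]

theorem norm_trunc_sub_self_le (v : Ell2 ω) : ‖trunc ω hS v - v‖ ≤ 2 * ‖v‖ := by
  linarith [norm_sub_le (trunc ω hS v) v, norm_trunc_le ω hS v]

/-- Truncation only affects `C δ_x` for `x` close to the boundary, if `C` has finite range. -/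
theorem sum_norm_trunc_sub_le {C B : Ω.OperatorFamily} {s : ℝ} (hB : HasRange B s) {M : ℝ}
    (hM0 : 0 ≤ M) (hM : ‖B ω‖ ≤ M) {ε : ℝ} (hCB : ‖C ω - B ω‖ ≤ ε) :
    ∑ x ∈ pointsIn ω hS, ‖trunc ω hS (C ω (delta ω x)) - C ω (delta ω x)‖ ≤
      2 * ε * (pointsIn ω hS).card +
        2 * M * (pointsIn ω (isBounded_thickening_frontier hS s)).card := by
  classical
  have h1 : ∀ x, ‖trunc ω hS (C ω (delta ω x)) - C ω (delta ω x)‖ ≤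
      2 * ε + ‖trunc ω hS (B ω (delta ω x)) - B ω (delta ω x)‖ := fun x => by
    have e : trunc ω hS (C ω (delta ω x)) - C ω (delta ω x) =
        (trunc ω hS ((C ω - B ω) (delta ω x)) - (C ω - B ω) (delta ω x)) +
          (trunc ω hS (B ω (delta ω x)) - B ω (delta ω x)) := by
      rw [sub_apply, trunc_sub]; abel
    rw [e]
    have h2 := norm_trunc_sub_self_le ω hS ((C ω - B ω) (delta ω x))
    have h3 := norm_apply_delta_le ω (C ω - B ω) x
    refine (norm_add_le _ _).trans ?_
    linarith
  have h2 : ∀ x ∈ pointsIn ω hS, ‖trunc ω hS (B ω (delta ω x)) - B ω (delta ω x)‖ ≤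
      if (x : Euc d) ∈ Metric.thickening s (frontier S) then 2 * M else 0 := fun x hx => by
    split_ifs with h
    · have h3 := norm_trunc_sub_self_le ω hS (B ω (delta ω x))
      have h4 := norm_apply_delta_le ω (B ω) x
      linarith
    · rw [trunc_eq_self, sub_self, norm_zero]
      intro y hy
      refine hB.eq_zero ω x y (le_of_not_gt fun hd => h ?_)
      exact mem_thickening_frontier (fun hiff => hy (hiff.1 (mem_pointsIn.1 hx))) hd
  refine (Finset.sum_le_sum fun x hx => (h1 x).trans (add_le_add_right (h2 x hx) _)).trans ?_
  rw [Finset.sum_add_distrib, Finset.sum_const, nsmul_eq_mul, mul_comm, ← Finset.sum_filter,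
    Finset.sum_const, nsmul_eq_mul, mul_comm (_ : ℝ) (2 * M)]
  refine add_le_add_right (mul_le_mul_of_nonneg_left ?_ (by positivity)) _
  exact_mod_cast Finset.card_le_card fun x hx => mem_pointsIn.2 (Finset.mem_filter.1 hx).2

end Trunc

theorem exists_eventually_card_le (ω : Ω.Point) {Q : ℕ → Set (Euc d)} (hQ : IsVanHove Q) :
    ∃ K : ℝ, 0 < K ∧ ∀ᶠ n in atTop,
      (volume.real (Q n))⁻¹ * ((pointsIn ω (hQ.isBounded n)).card : ℝ) ≤ K := by
  obtain ⟨C, hC0, hC⟩ := exists_card_pointsIn_le ω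
  refine ⟨2 * C + 1, by positivity, ?_⟩
  filter_upwards [(hQ.tendsto 2 two_pos).eventually_le_const one_pos] with n hn
  have hp := hQ.volume_real_pos n
  rw [div_le_one hp] at hn
  have hsub : Metric.thickening 1 (Q n) ⊆ Q n ∪ Metric.thickening 2 (frontier (Q n)) := by
    intro x hx
    obtain ⟨y, hy, hxy⟩ := Metric.mem_thickening_iff.1 hx
    by_cases hxQ : x ∈ Q n
    · exact Or.inl hxQ
    · exact Or.inr (mem_thickening_frontier (fun h => hxQ (h.2 hy)) (by linarith))
  have h1 := (measureReal_mono (μ := volume) hsub ((hQ.isBounded n).union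
    (isBounded_thickening_frontier (hQ.isBounded n) _)).measure_lt_top.ne).trans
      (measureReal_union_le _ _)
  rw [inv_mul_eq_div, div_le_iff₀ hp]
  have h2 := hC _ (hQ.isBounded n)
  nlinarith

/-- Cutting off the vectors `C δ_x`, for `x` in `Q n`, outside `Q n` causes an error of smaller
order than the volume. -/
theorem tendsto_sum_norm_trunc_sub (ω : Ω.Point) {Q : ℕ → Set (Euc d)} (hQ : IsVanHove Q)
    {C : Ω.OperatorFamily} (hC : C ∈ Ω.tightBindingAlgebra) :
    Tendsto (fun n => (volume.real (Q n))⁻¹ * ∑ x ∈ pointsIn ω (hQ.isBounded n),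
      ‖trunc ω (hQ.isBounded n) (C ω (delta ω x)) - C ω (delta ω x)‖) atTop (𝓝 0) := by
  obtain ⟨K, hK0, hK⟩ := exists_eventually_card_le ω hQ
  refine tendsto_order.2 ⟨fun a ha => Eventually.of_forall fun n => ha.trans_le (by positivity),
    fun a ha => ?_⟩
  obtain ⟨B, hB, hCB⟩ := hC (a / (4 * K)) (by positivity)
  obtain ⟨s, hs⟩ := isFiniteRange_iff.1 hB
  obtain ⟨M, hM0, hM⟩ := hs.exists_norm_bound
  have h1 := (tendsto_card_boundary ω hQ hs.pos).const_mul (2 * M)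
  rw [mul_zero] at h1
  filter_upwards [hK, h1.eventually_lt_const (show 0 < a / 2 by positivity)] with n h2 h3
  have hp := hQ.volume_real_pos n
  have h4 := mul_le_mul_of_nonneg_left
    (sum_norm_trunc_sub_le ω (hQ.isBounded n) hs hM0 (hM ω) (hCB ω)) (inv_nonneg.2 hp.le)
  refine h4.trans_lt ?_
  have h5 := mul_le_mul_of_nonneg_left h2 (show 0 ≤ 2 * (a / (4 * K)) by positivity)
  have h6 : 2 * (a / (4 * K)) * K = a / 2 := by field_simp; norm_num
  rw [mul_add]
  nlinarith

/-- The truncated powers `(P A)^k δ_x`, with `P` the projection onto `ℓ²(S ∩ ω)`. -/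
noncomputable def truncPow (A : Ω.OperatorFamily) (ω : Ω.Point) {S : Set (Euc d)}
    (hS : Bornology.IsBounded S) (x : ω.1.carrier) : ℕ → Ell2 ω
  | 0 => delta ω x
  | k + 1 => trunc ω hS (A ω (truncPow A ω hS x k))

theorem norm_truncPow_succ_sub_le (A : Ω.OperatorFamily) (ω : Ω.Point) {S : Set (Euc d)}
    (hS : Bornology.IsBounded S) (x : ω.1.carrier) (k : ℕ) :
    ‖truncPow A ω hS x (k + 1) - (A ω ^ (k + 1)) (delta ω x)‖ ≤
      ‖A ω‖ * ‖truncPow A ω hS x k - (A ω ^ k) (delta ω x)‖ +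
        ‖trunc ω hS ((A ω ^ (k + 1)) (delta ω x)) - (A ω ^ (k + 1)) (delta ω x)‖ := by
  have h : (A ω ^ (k + 1)) (delta ω x) = A ω ((A ω ^ k) (delta ω x)) := by
    rw [pow_succ']; rfl
  have e : truncPow A ω hS x (k + 1) - (A ω ^ (k + 1)) (delta ω x) =
      trunc ω hS (A ω (truncPow A ω hS x k - (A ω ^ k) (delta ω x))) +
        (trunc ω hS ((A ω ^ (k + 1)) (delta ω x)) - (A ω ^ (k + 1)) (delta ω x)) := by
    rw [h, map_sub, trunc_sub, truncPow]; abel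
  rw [e]
  exact (norm_add_le _ _).trans (add_le_add_left
    ((norm_trunc_le ω hS _).trans ((A ω).le_opNorm _)) _)

theorem tendsto_sum_norm_truncPow_sub (ω : Ω.Point) {Q : ℕ → Set (Euc d)} (hQ : IsVanHove Q)
    {A : Ω.OperatorFamily} (hA : A ∈ Ω.tightBindingAlgebra) (k : ℕ) :
    Tendsto (fun n => (volume.real (Q n))⁻¹ * ∑ x ∈ pointsIn ω (hQ.isBounded n),
      ‖truncPow A ω (hQ.isBounded n) x k - (A ω ^ k) (delta ω x)‖) atTop (𝓝 0) := by
  induction k with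
  | zero => simp [truncPow]
  | succ k ih =>
    have h := (ih.const_mul ‖A ω‖).add
      (tendsto_sum_norm_trunc_sub ω hQ (pow_mem_tightBindingAlgebra hA (k + 1)))
    rw [mul_zero, add_zero] at h
    refine squeeze_zero (fun n => by positivity) (fun n => ?_) h
    rw [mul_left_comm, ← mul_add]
    refine mul_le_mul_of_nonneg_left ?_ (by positivity)
    rw [Finset.mul_sum, ← Finset.sum_add_distrib]
    exact Finset.sum_le_sum fun x _ => norm_truncPow_succ_sub_le A ω _ x k

/-! ### Finite volume restrictions -/

theorem restriction_apply (A : Ω.OperatorFamily) (ω : Ω.Point) {S : Set (Euc d)}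
    (x y : {x : ω.1.carrier | (x : Euc d) ∈ S}) :
    restriction A ω S x y = A ω (delta ω y) x := inner_delta ω x.1 _

theorem trunc_truncPow (A : Ω.OperatorFamily) (ω : Ω.Point) {S : Set (Euc d)}
    (hS : Bornology.IsBounded S) {x : ω.1.carrier} (hx : (x : Euc d) ∈ S) (k : ℕ) :
    trunc ω hS (truncPow A ω hS x k) = truncPow A ω hS x k := by
  refine trunc_eq_self ω hS fun y hy => ?_
  cases k with
  | zero => exact delta_apply_of_ne ω fun h => hy (h ▸ hx)
  | succ k => exact trunc_apply_of_notMem ω hS _ hy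

section Matrix

variable (A : Ω.OperatorFamily) (ω : Ω.Point) {S : Set (Euc d)} (hS : Bornology.IsBounded S)
  [Fintype {x : ω.1.carrier | (x : Euc d) ∈ S}]

theorem sum_pointsIn {E : Type*} [AddCommMonoid E] (g : ω.1.carrier → E) :
    ∑ x ∈ pointsIn ω hS, g x = ∑ x : {x : ω.1.carrier | (x : Euc d) ∈ S}, g x :=
  Finset.sum_subtype _ (fun _ => mem_pointsIn) g

theorem apply_trunc (T : Ell2 ω →L[ℂ] Ell2 ω) (v : Ell2 ω) (y : ω.1.carrier) :
    T (trunc ω hS v) y =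
      ∑ x : {x : ω.1.carrier | (x : Euc d) ∈ S}, v x * T (delta ω x) y := by
  rw [trunc, sum_pointsIn ω hS fun z => v z • delta ω z, map_sum, lp.coeFn_sum, Finset.sum_apply]
  refine Finset.sum_congr rfl fun x _ => ?_
  rw [map_smul]
  rfl

/-- Entries of powers of the restricted matrix, in terms of the unrestricted operator. -/
theorem restriction_pow_apply [DecidableEq {x : ω.1.carrier | (x : Euc d) ∈ S}]
    (x y : {x : ω.1.carrier | (x : Euc d) ∈ S}) (k : ℕ) :
    (restriction A ω S ^ k) y x = truncPow A ω hS x k y := by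
  induction k generalizing y with
  | zero =>
    rw [pow_zero, truncPow, Matrix.one_apply]
    split_ifs with h
    · rw [h, delta_apply_self]
    · exact (delta_apply_of_ne ω fun h' => h (Subtype.ext h')).symm
  | succ k ih =>
    rw [pow_succ', Matrix.mul_apply, truncPow, trunc_apply_of_mem ω hS _ y.2,
      ← trunc_truncPow A ω hS x.2 k, apply_trunc]
    refine Finset.sum_congr rfl fun z _ => ?_
    rw [ih, restriction_apply, mul_comm]

end Matrix

/-- An eigenvector of the restriction, extended by zero, is an eigenvector of the compression of
`A_ω`, whose norm is at most that of `A_ω`. -/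
theorem abs_eigenvalues_le (A : Ω.OperatorFamily) (ω : Ω.Point) {S : Set (Euc d)}
    (hS : Bornology.IsBounded S) [Fintype {x : ω.1.carrier | (x : Euc d) ∈ S}]
    [DecidableEq {x : ω.1.carrier | (x : Euc d) ∈ S}]
    (hM : (restriction A ω S).IsHermitian) (i : {x : ω.1.carrier | (x : Euc d) ∈ S}) :
    |hM.eigenvalues i| ≤ ‖A ω‖ := by
  classical
  set b : {x : ω.1.carrier | (x : Euc d) ∈ S} → ℂ := ⇑(hM.eigenvectorBasis i) with hb
  have heig : ∀ z, ∑ w, restriction A ω S z w * b w = hM.eigenvalues i * b z := fun z => by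
    have := congrFun (hM.mulVec_eigenvectorBasis i) z
    simpa [Matrix.mulVec, dotProduct, hb] using this
  let V : Ell2 ω := ∑ z ∈ pointsIn ω hS, (if h : (z : Euc d) ∈ S then b ⟨z, h⟩ else 0) • delta ω z
  have hVz : ∀ z : {x : ω.1.carrier | (x : Euc d) ∈ S}, V z = b z := fun z => by
    have hz : (z.1 : Euc d) ∈ S := z.2
    rw [sum_smul_delta_apply, if_pos (mem_pointsIn.2 hz), dif_pos hz]
  have hVn : ∀ y : ω.1.carrier, (y : Euc d) ∉ S → V y = 0 := fun y hy => by
    rw [sum_smul_delta_apply, if_neg fun h => hy (mem_pointsIn.1 h)]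
  have hVA : trunc ω hS (A ω V) = (hM.eigenvalues i : ℂ) • V := by
    ext y
    change _ = (hM.eigenvalues i : ℂ) * V y
    by_cases hy : (y : Euc d) ∈ S
    · rw [trunc_apply_of_mem ω hS _ hy, ← trunc_eq_self ω hS hVn, apply_trunc,
        trunc_eq_self ω hS hVn]
      have := heig ⟨y, hy⟩
      rw [← hVz ⟨y, hy⟩] at this
      rw [← this]
      refine Finset.sum_congr rfl fun z _ => ?_
      rw [hVz, restriction_apply, mul_comm]
    · rw [trunc_apply_of_notMem ω hS _ hy, hVn y hy, mul_zero]
  have hV0 : 0 < ‖V‖ := by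
    refine norm_pos_iff.2 fun h0 => ?_
    refine hM.eigenvectorBasis.orthonormal.ne_zero i ?_
    ext z
    change b z = 0
    rw [← hVz, h0]
    rfl
  have h1 := (norm_trunc_le ω hS (A ω V)).trans ((A ω).le_opNorm V)
  rw [hVA, norm_smul, Complex.norm_real, Real.norm_eq_abs] at h1
  exact le_of_mul_le_mul_right h1 hV0

end DDSF

/-! ### Traces of functions of the finite volume restrictions -/

theorem trace_cfc_eq_sum_eigenvalues {n : Type*} [Fintype n] [DecidableEq n] {M : Matrix n n ℂ}
    (hM : M.IsHermitian) (g : ℝ → ℝ) :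
    (cfc g M).trace = ∑ i, ((g (hM.eigenvalues i) : ℝ) : ℂ) := by
  rw [hM.cfc_eq, Matrix.IsHermitian.cfc, Unitary.conjStarAlgAut_apply, Matrix.trace_mul_comm,
    ← mul_assoc]
  simp [Matrix.trace_diagonal]

theorem sum_eval_eigenvalues {n : Type*} [Fintype n] [DecidableEq n] {M : Matrix n n ℂ}
    (hM : M.IsHermitian) (p : Polynomial ℝ) :
    ∑ i, p.eval (hM.eigenvalues i) =
      ∑ k ∈ Finset.range (p.natDegree + 1), p.coeff k * ∑ i, ((M ^ k) i i).re := by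
  have h := trace_cfc_eq_sum_eigenvalues hM p.eval
  rw [cfc_polynomial p M hM.isSelfAdjoint, Polynomial.aeval_eq_sum_range, Matrix.trace_sum] at h
  have h' := congrArg Complex.re h
  rw [Complex.re_sum, Complex.re_sum] at h'
  simp only [Complex.ofReal_re] at h'
  rw [← h']
  refine Finset.sum_congr rfl fun k _ => ?_
  rw [Matrix.trace_smul, Complex.smul_re, smul_eq_mul, Matrix.trace, Complex.re_sum]
  rfl

namespace DDSF

variable {d : ℕ} {Ω : DDSF d}

theorem integral_finiteVolumeMeasure_eq_sum (A : Ω.OperatorFamily) (hsa : ∀ ω, IsSelfAdjoint (A ω))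
    (ω : Ω.Point) {S : Set (Euc d)} (hS : Bornology.IsBounded S)
    [Fintype {x : ω.1.carrier | (x : Euc d) ∈ S}]
    [DecidableEq {x : ω.1.carrier | (x : Euc d) ∈ S}] (φ : BoundedContinuousFunction ℝ ℝ) :
    ∫ E, φ E ∂(finiteVolumeMeasure A hsa ω S hS : Measure ℝ) =
      (volume.real S)⁻¹ * ∑ i, φ ((restriction_isHermitian hsa ω S).eigenvalues i) := by
  have h := integral_finiteVolumeMeasure A hsa ω S hS φ
  have e := trace_cfc_eq_sum_eigenvalues (restriction_isHermitian hsa ω S) φ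
  have h2 : ((∫ E, φ E ∂(finiteVolumeMeasure A hsa ω S hS : Measure ℝ) : ℝ) : ℂ) =
      ((volume.real S)⁻¹ : ℝ) * ∑ i,
        ((φ ((restriction_isHermitian hsa ω S).eigenvalues i) : ℝ) : ℂ) := by
    rw [← e]
    convert h
  exact_mod_cast h2

theorem diagonal_aeval (A : Ω.OperatorFamily) (p : Polynomial ℝ) (ω : Ω.Point)
    (x : ω.1.carrier) : diagonal (fun ω => Polynomial.aeval (A ω) p) ω x =
      ∑ k ∈ Finset.range (p.natDegree + 1),
        p.coeff k * diagonal (fun ω => A ω ^ k) ω x := by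
  have h : ∀ T : Ell2 ω →L[ℂ] Ell2 ω, ∀ v : Ell2 ω, (Polynomial.aeval T p) v x =
      ∑ k ∈ Finset.range (p.natDegree + 1), (p.coeff k : ℂ) * (T ^ k) v x := fun T v => by
    rw [Polynomial.aeval_eq_sum_range, sum_apply, lp.coeFn_sum,
      Finset.sum_apply]
    refine Finset.sum_congr rfl fun k _ => ?_
    change (p.coeff k • (T ^ k) v) x = _
    simp
  rw [diagonal, h, Complex.re_sum]
  exact Finset.sum_congr rfl fun k _ => Complex.re_ofReal_mul _ _

/-- Comparison of the spectrum of the restriction to `S` with the diagonal of the functional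
calculus of `A_ω`, through a polynomial approximation `p` of `φ`. -/
theorem abs_integral_finiteVolumeMeasure_sub_le (A : Ω.OperatorFamily)
    (hsa : ∀ ω, IsSelfAdjoint (A ω)) (ω : Ω.Point) {S : Set (Euc d)}
    (hS : Bornology.IsBounded S) (φ : BoundedContinuousFunction ℝ ℝ) {p : Polynomial ℝ}
    {M ε : ℝ} (hM : ‖A ω‖ ≤ M) (hε : 0 ≤ ε) (hp : ∀ x, |x| ≤ M → |p.eval x - φ x| ≤ ε) :
    |∫ E, φ E ∂(finiteVolumeMeasure A hsa ω S hS : Measure ℝ) -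
      (volume.real S)⁻¹ * ∑ x ∈ pointsIn ω hS, diagonal (fun ω => opCfc φ (A ω)) ω x| ≤
    (volume.real S)⁻¹ * (2 * ε * (pointsIn ω hS).card +
      ∑ k ∈ Finset.range (p.natDegree + 1), |p.coeff k| * ∑ x ∈ pointsIn ω hS,
        ‖truncPow A ω hS x k - (A ω ^ k) (delta ω x)‖) := by
  classical
  let hF : Fintype {x : ω.1.carrier | (x : Euc d) ∈ S} := (finite_inter ω hS).fintype
  have hH := restriction_isHermitian hsa ω S
  rw [integral_finiteVolumeMeasure_eq_sum A hsa ω hS φ, ← mul_sub, abs_mul,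
    abs_of_nonneg (inv_nonneg.2 measureReal_nonneg)]
  refine mul_le_mul_of_nonneg_left ?_ (inv_nonneg.2 measureReal_nonneg)
  have hcard : (pointsIn ω hS).card = Fintype.card {x : ω.1.carrier | (x : Euc d) ∈ S} := by
    have := sum_pointsIn ω hS fun _ => 1
    simpa using this
  have h1 : |∑ i, φ (hH.eigenvalues i) - ∑ i, p.eval (hH.eigenvalues i)| ≤
      (pointsIn ω hS).card * ε := by
    rw [← Finset.sum_sub_distrib, hcard]
    refine (Finset.abs_sum_le_sum_abs _ _).trans ((Finset.sum_le_sum fun i _ => ?_).trans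
      (by rw [Finset.sum_const, nsmul_eq_mul]; rfl))
    rw [abs_sub_comm]
    exact hp _ ((abs_eigenvalues_le A ω hS hH i).trans hM)
  have h2 : |∑ x ∈ pointsIn ω hS, diagonal (fun ω => Polynomial.aeval (A ω) p) ω x -
      ∑ x ∈ pointsIn ω hS, diagonal (fun ω => opCfc φ (A ω)) ω x| ≤
      (pointsIn ω hS).card * ε := by
    rw [← Finset.sum_sub_distrib]
    refine (Finset.abs_sum_le_sum_abs _ _).trans ((Finset.sum_le_sum fun x _ => ?_).trans
      (by rw [Finset.sum_const, nsmul_eq_mul]))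
    rw [abs_sub_comm, diagonal, diagonal, ← Complex.sub_re]
    refine (Complex.abs_re_le_norm _).trans ?_
    exact (norm_apply_le ω ((opCfc φ (A ω) - Polynomial.aeval (A ω) p) (delta ω x)) x).trans
      ((norm_apply_delta_le ω _ x).trans
        (norm_opCfc_sub_aeval_le (hsa ω) hM φ.continuous hε hp))
  have h3 : |∑ i, p.eval (hH.eigenvalues i) -
      ∑ x ∈ pointsIn ω hS, diagonal (fun ω => Polynomial.aeval (A ω) p) ω x| ≤
      ∑ k ∈ Finset.range (p.natDegree + 1), |p.coeff k| * ∑ x ∈ pointsIn ω hS,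
        ‖truncPow A ω hS x k - (A ω ^ k) (delta ω x)‖ := by
    have e1 : ∑ i, p.eval (hH.eigenvalues i) = ∑ k ∈ Finset.range (p.natDegree + 1),
        p.coeff k * ∑ x ∈ pointsIn ω hS, (truncPow A ω hS x k x).re := by
      rw [sum_eval_eigenvalues]
      refine Finset.sum_congr rfl fun k _ => ?_
      rw [sum_pointsIn ω hS fun x => (truncPow A ω hS x k x).re]
      simp only [restriction_pow_apply A ω hS]
    have e2 : ∑ x ∈ pointsIn ω hS, diagonal (fun ω => Polynomial.aeval (A ω) p) ω x =
        ∑ k ∈ Finset.range (p.natDegree + 1),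
          p.coeff k * ∑ x ∈ pointsIn ω hS, diagonal (fun ω => A ω ^ k) ω x := by
      simp only [diagonal_aeval, Finset.mul_sum]
      exact Finset.sum_comm
    rw [e1, e2, ← Finset.sum_sub_distrib]
    refine (Finset.abs_sum_le_sum_abs _ _).trans (Finset.sum_le_sum fun k _ => ?_)
    rw [← mul_sub, abs_mul, ← Finset.sum_sub_distrib]
    refine mul_le_mul_of_nonneg_left ((Finset.abs_sum_le_sum_abs _ _).trans
      (Finset.sum_le_sum fun x _ => ?_)) (abs_nonneg _)
    rw [diagonal, ← Complex.sub_re]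
    exact (Complex.abs_re_le_norm _).trans
      (norm_apply_le ω (truncPow A ω hS x k - (A ω ^ k) (delta ω x)) x)
  calc _ ≤ _ := abs_sub_le _ (∑ i, p.eval (hH.eigenvalues i)) _
    _ ≤ _ := add_le_add_right (abs_sub_le _
        (∑ x ∈ pointsIn ω hS, diagonal (fun ω => Polynomial.aeval (A ω) p) ω x) _) _
    _ ≤ _ := by linarith

/-- Asymptotically, `tr φ(A_ω|_Q)` and the trace of `φ(A_ω)` over the points in `Q` agree per unit
volume. -/
theorem tendsto_integral_finiteVolumeMeasure_sub {A : Ω.OperatorFamily}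
    (hA : A ∈ Ω.tightBindingAlgebra) (hsa : ∀ ω, IsSelfAdjoint (A ω)) (ω : Ω.Point)
    {Q : ℕ → Set (Euc d)} (hQ : IsVanHove Q) (φ : BoundedContinuousFunction ℝ ℝ) :
    Tendsto (fun n => ∫ E, φ E ∂(finiteVolumeMeasure A hsa ω (Q n) (hQ.isBounded n) : Measure ℝ) -
      (volume.real (Q n))⁻¹ *
        ∑ x ∈ pointsIn ω (hQ.isBounded n), diagonal (fun ω => opCfc φ (A ω)) ω x)
      atTop (𝓝 0) := by
  obtain ⟨K, hK0, hK⟩ := exists_eventually_card_le ω hQ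
  rw [Metric.tendsto_nhds]
  intro a ha
  have hε : 0 < a / (4 * K) := by positivity
  obtain ⟨p, hp⟩ := exists_polynomial_near_of_continuousOn (-‖A ω‖) ‖A ω‖ φ
    φ.continuous.continuousOn _ hε
  have hlim : Tendsto (fun n => ∑ k ∈ Finset.range (p.natDegree + 1), |p.coeff k| *
      ((volume.real (Q n))⁻¹ * ∑ x ∈ pointsIn ω (hQ.isBounded n),
        ‖truncPow A ω (hQ.isBounded n) x k - (A ω ^ k) (delta ω x)‖)) atTop (𝓝 0) := by
    rw [← Finset.sum_const_zero (s := Finset.range (p.natDegree + 1))]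
    refine tendsto_finsetSum _ fun k _ => ?_
    simpa using (tendsto_sum_norm_truncPow_sub ω hQ hA k).const_mul |p.coeff k|
  filter_upwards [hK, hlim.eventually_lt_const (show 0 < a / 2 by positivity)] with n h1 h2
  rw [Real.dist_eq, sub_zero]
  refine (abs_integral_finiteVolumeMeasure_sub_le A hsa ω (hQ.isBounded n) φ le_rfl hε.le
    fun x hx => (hp x (abs_le.1 hx)).le).trans_lt ?_
  have h5 := mul_le_mul_of_nonneg_left h1 (show 0 ≤ 2 * (a / (4 * K)) by positivity)
  have h6 : 2 * (a / (4 * K)) * K = a / 2 := by field_simp; norm_num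
  rw [mul_add, Finset.mul_sum]
  simp only [mul_left_comm _ |p.coeff _|]
  nlinarith

/-! ### Existence of weights and of van Hove sequences -/

variable (d) in
theorem exists_weight : ∃ f : C_c(Euc d, ℝ), 0 ≤ f ∧ ∫ x, f x = 1 := by
  let b : ContDiffBump (0 : Euc d) := ⟨1, 2, one_pos, one_lt_two⟩
  exact ⟨⟨⟨b.normed volume, b.continuous_normed⟩, b.hasCompactSupport_normed⟩,
    fun x => b.nonneg_normed x, b.integral_normed⟩

variable (d) in
theorem isVanHove_closedBall : IsVanHove fun n : ℕ => Metric.closedBall (0 : Euc d) (n + 1) where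
  isBounded := fun n => Metric.isBounded_closedBall
  volume_pos := fun n => Metric.measure_closedBall_pos _ _ (by positivity)
  tendsto := fun s hs => by
    set c := volume.real (Metric.ball (0 : Euc d) 1)
    have hc : 0 < c := ENNReal.toReal_pos (Metric.measure_ball_pos _ _ one_pos).ne'
      measure_ball_lt_top.ne
    have hvol : ∀ r : ℝ, 0 ≤ r → volume.real (Metric.closedBall (0 : Euc d) r) = r ^ d * c :=
      fun r hr => by
        rw [measureReal_def, Measure.addHaar_closedBall _ _ hr, ENNReal.toReal_mul,
          ENNReal.toReal_ofReal (by positivity), finrank_euclideanSpace_fin]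
        rfl
    have hinv : Tendsto (fun n : ℕ => s / ((n : ℝ) + 1)) atTop (𝓝 0) :=
      tendsto_const_nhds.div_atTop (tendsto_natCast_atTop_atTop.atTop_add tendsto_const_nhds)
    have hlim : Tendsto (fun n : ℕ => (1 + s / ((n : ℝ) + 1)) ^ d - (1 - s / ((n : ℝ) + 1)) ^ d)
        atTop (𝓝 0) := by
      simpa using ((hinv.const_add 1).pow d).sub ((hinv.const_sub 1).pow d)
    refine squeeze_zero' (Eventually.of_forall fun n => by positivity) ?_ hlim
    obtain ⟨N, hN⟩ := exists_nat_ge s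
    filter_upwards [eventually_ge_atTop N] with n hn
    have hsn : 0 < (n : ℝ) + 1 - s := by
      have : (N : ℝ) ≤ n := by exact_mod_cast hn
      linarith
    have hpos : (0 : ℝ) < (n : ℝ) + 1 := by positivity
    -- The neighbourhood of the sphere lies between two concentric balls.
    have hsub : Metric.thickening s (frontier (Metric.closedBall (0 : Euc d) (n + 1))) ⊆
        Metric.closedBall 0 (n + 1 + s) \ Metric.ball 0 (n + 1 - s) := by
      intro x hx
      obtain ⟨y, hy, hxy⟩ := Metric.mem_thickening_iff.1 hx
      have hy' : ‖y‖ = n + 1 := by simpa using Metric.frontier_closedBall_subset_sphere hy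
      rw [dist_eq_norm] at hxy
      rw [Set.mem_sdiff, mem_closedBall_zero_iff, mem_ball_zero_iff, not_lt]
      have h1 := norm_le_norm_add_norm_sub' x y
      have h2 := norm_le_norm_add_norm_sub x y
      constructor <;> linarith
    have hball : volume.real (Metric.ball (0 : Euc d) (n + 1 - s)) = (n + 1 - s) ^ d * c := by
      rw [measureReal_def, Measure.addHaar_ball_of_pos _ _ hsn, ENNReal.toReal_mul,
        ENNReal.toReal_ofReal (by positivity), finrank_euclideanSpace_fin]
      rfl
    have hle := measureReal_mono (μ := volume) hsub
      ((Metric.isBounded_closedBall.subset sdiff_subset).measure_lt_top.ne)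
    rw [measureReal_sdiff (h₁ := measure_closedBall_lt_top.ne) (Metric.ball_subset_closedBall.trans
      (Metric.closedBall_subset_closedBall (by linarith))) Metric.isOpen_ball.measurableSet,
      hvol _ (by positivity), hball] at hle
    rw [hvol _ hpos.le, div_le_iff₀ (by positivity)]
    refine hle.trans (le_of_eq ?_)
    rw [sub_mul, ← mul_assoc, ← mul_assoc, ← mul_pow, ← mul_pow, add_mul, sub_mul,
      div_mul_cancel₀ _ hpos.ne', one_mul]

end DDSF

end Delonedyn

/-! ### Convergence of the finite volume measures -/

open Delonedyn Delonedyn.DDSF in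
theorem mainTheorem2 {d : ℕ} (Ω : Delonedyn.DDSF d) (hΩ : Ω.IsUniquelyErgodic)
    (μ : Measure Ω.Point) (hμ : Ω.IsInvariantProbability μ)
    (A : Ω.OperatorFamily) (hA : A ∈ Ω.tightBindingAlgebra) (hsa : ∀ ω, IsSelfAdjoint (A ω)) :
    ∃ ρ : FiniteMeasure ℝ, Delonedyn.DDSF.IsDensityOfStates μ A ρ ∧
      ∀ (Q : ℕ → Set (Delonedyn.Euc d)) (hQ : Delonedyn.IsVanHove Q) (ω : Ω.Point),
        Tendsto (fun n => Delonedyn.DDSF.finiteVolumeMeasure A hsa ω (Q n) (hQ.isBounded n))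
          atTop (𝓝 ρ) := by
  have := hμ.isProbabilityMeasure
  have hfin : ∀ f : C_c(Euc d, ℝ), 0 ≤ f → IsFiniteMeasure (densityOfStates μ A f) :=
    fun f hf => isFiniteMeasure_densityOfStates μ hA hsa hf
  -- The finite volume measures converge, whichever weight is used to define the limit.
  have hlim : ∀ (f : C_c(Euc d, ℝ)) (hf : 0 ≤ f), ∫ x, f x = 1 →
      ∀ (Q : ℕ → Set (Euc d)) (hQ : IsVanHove Q) (ω : Ω.Point),
        Tendsto (fun n => finiteVolumeMeasure A hsa ω (Q n) (hQ.isBounded n)) atTop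
          (𝓝 (⟨densityOfStates μ A f, hfin f hf⟩ : FiniteMeasure ℝ)) := by
    intro f hf hf1 Q hQ ω
    refine FiniteMeasure.tendsto_iff_forall_integral_tendsto.2 fun φ => ?_
    have h1 := tendsto_average_pointsIn (f := f) hΩ hμ hQ ω
      (isAlmostLocal_diagonal (opCfc_mem_tightBindingAlgebra hA hsa φ.continuous))
      f.continuous f.hasCompactSupport hf hf1
    have h2 := (tendsto_integral_finiteVolumeMeasure_sub hA hsa ω hQ φ).add h1
    rw [zero_add, ← integral_densityOfStates μ hA hsa hf φ.continuous
      (fun x => φ.norm_coe_le_norm x)] at h2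
    simpa using h2
  obtain ⟨f₀, hf₀, hf₀1⟩ := exists_weight d
  refine ⟨⟨densityOfStates μ A f₀, hfin f₀ hf₀⟩, fun f hf hf1 B hB => ?_, hlim f₀ hf₀ hf₀1⟩
  obtain ⟨ω⟩ : Nonempty Ω.Point := nonempty_of_isProbabilityMeasure μ
  have heq := tendsto_nhds_unique (hlim f₀ hf₀ hf₀1 _ (isVanHove_closedBall d) ω)
    (hlim f hf hf1 _ (isVanHove_closedBall d) ω)
  rw [heq]
  exact densityOfStates_eq_tau μ hA hsa hf hB
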